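/- **Theorem (Reed–Muller codes achieve capacity on the BEC).** For $n\ge 0$ and $r\ge 0$ let $\mathrm{RM}(n,r)\subseteq \mathbb F_2^{N}$, $N=2^n$, be the Reed–Muller code of order $r$: the binary linear code generated by all rows of Hamming weight at least $2^{n-r}$ of the Kronecker power $\left(\begin{smallmatrix}1&0\\1&1\end{smallmatrix}\right)^{\otimes n}$. Its rate is $\frac1N\dim \mathrm{RM}(n,r)$. Let $\mathrm{BEC}(\epsilon)$ be the binary erasure channel, which replaces each transmitted bit, independently, by an erasure symbol with probability $\epsilon$ and otherwise leaves it unchanged. Let $X$ be uniformly distributed on the code and let $Y$ be the result of sending $X$ over $\mathrm{BEC}(\epsilon)$. The bit-MAP decoder of position $i$ outputs the value of $X_i$ with the larger posterior probability given its observation, or a failure symbol "?" in case of a tie; its error probability is the probability that its output is not $X_i$ (a failure counts as an error). Consider a sequence of codes $\mathrm{RM}(n,r_n)$, with $n$ running in increasing order through all natural numbers or through an infinite subset of them, whose rates $R_n$ converge to $R$, where $0<R<1$. Then for every $0\le\epsilon<1-R$ and every $\delta>0$ there is an $n_0$ such that for all $n>n_0$ in the sequence and for every position $i$, the error probability of the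 bit-MAP decoder of position $i$ of $\mathrm{RM}(n,r_n)$ on $\mathrm{BEC}(\epsilon)$ is at most $\delta$, both when the decoder observes all of $Y$ and when it observes only $Y_{\sim i}$, that is, all channel outputs except $Y_i$. In particular the bit error probability (the average over $i$) is at most $\delta$. -/

import Mathlib

open Filter Topology

/-- The `n`-fold Kronecker power of the matrix `(1 0; 1 1)` over the field with two elements.
Rows and columns are indexed by `n`-tuples of indices of the `2 × 2` matrix, so that there are
`2 ^ n` of each, and entries of a Kronecker product are products of entries. -/
def hadamardPow (n : ℕ) : Matrix (Fin n → Fin 2) (Fin n → Fin 2) (ZMod 2) :=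
  Matrix.of fun a b => ∏ j, (!![1, 0; 1, 1] : Matrix (Fin 2) (Fin 2) (ZMod 2)) (a j) (b j)

/-- The Reed–Muller code of block length `2 ^ n` and order `r`: the binary linear code generated
by all rows of Hamming weight at least `2 ^ (n - r)` of the `n`-fold Kronecker power of
`(1 0; 1 1)`. (For `r ≥ n` this is the whole space.) -/
def reedMuller (n r : ℕ) : Submodule (ZMod 2) ((Fin n → Fin 2) → ZMod 2) :=
  Submodule.span (ZMod 2)
    {v | ∃ a : Fin n → Fin 2, v = hadamardPow n a ∧ 2 ^ (n - r) ≤ hammingNorm (hadamardPow n a)}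

section Coding

variable {ι : Type*} [Fintype ι] [DecidableEq ι] {β : Type*}

/-- The rate `K / N` of a binary linear code of dimension `K` and block length `N`. -/
noncomputable def codeRate (C : Submodule (ZMod 2) (ι → ZMod 2)) : ℝ :=
  (Module.finrank (ZMod 2) C : ℝ) / (Fintype.card ι : ℝ)

/-- Transition probability `W (y | x)` of the binary erasure channel with erasure probability
`ε`; the output `none` is the erasure symbol. -/
def becTransition (ε : ℝ) (x : ZMod 2) : Option (ZMod 2) → ℝ
  | none => ε
  | some b => if b = x then 1 - ε else 0

open scoped Classical in
/-- `P (X = x, Y = y)`, where `X` is uniformly distributed on the code `C` and `Y` is the result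
of sending the coordinates of `X` over independent uses of the erasure channel. -/
noncomputable def jointProb (C : Submodule (ZMod 2) (ι → ZMod 2)) (ε : ℝ)
    (x : ι → ZMod 2) (y : ι → Option (ZMod 2)) : ℝ :=
  (if x ∈ C then 1 / (Nat.card C : ℝ) else 0) * ∏ j, becTransition ε (x j) (y j)

open scoped Classical in
/-- The probability of an event described in terms of the pair `(X, Y)`. -/
noncomputable def eventProb (C : Submodule (ZMod 2) (ι → ZMod 2)) (ε : ℝ)
    (E : (ι → ZMod 2) → (ι → Option (ZMod 2)) → Prop) : ℝ :=
  ∑ x : ι → ZMod 2, ∑ y : ι → Option (ZMod 2), if E x y then jointProb C ε x y else 0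

/-- The posterior probability `P (X i = b | T Y = t)`, where `T Y` is the part of the channel
output that the decoder observes. -/
noncomputable def posterior (C : Submodule (ZMod 2) (ι → ZMod 2)) (ε : ℝ) (i : ι)
    (T : (ι → Option (ZMod 2)) → β) (t : β) (b : ZMod 2) : ℝ :=
  eventProb C ε (fun x y => x i = b ∧ T y = t) / eventProb C ε (fun _ y => T y = t)

open scoped Classical in
/-- The maximum a posteriori estimate of the code bit `X i` from the observation `t` of `T Y`:
the bit with the larger posterior probability, or the failure symbol `none` in case of a tie. -/
noncomputable def bitMAP (C : Submodule (ZMod 2) (ι → ZMod 2)) (ε : ℝ) (i : ι)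
    (T : (ι → Option (ZMod 2)) → β) (t : β) : Option (ZMod 2) :=
  if posterior C ε i T t 1 < posterior C ε i T t 0 then some 0
  else if posterior C ε i T t 0 < posterior C ε i T t 1 then some 1
  else none

/-- The probability that the maximum a posteriori estimate of `X i` from `T Y` is not `X i`.
A failure to decide counts as an error, so that this bounds from above the error probability
under every rule for resolving ties. -/
noncomputable def bitMAPErrorProb (C : Submodule (ZMod 2) (ι → ZMod 2)) (ε : ℝ) (i : ι)
    (T : (ι → Option (ZMod 2)) → β) : ℝ :=
  eventProb C ε (fun x y => bitMAP C ε i T (T y) ≠ some (x i))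

/-- The observation of all channel outputs. -/
def fullObs (y : ι → Option (ZMod 2)) : ι → Option (ZMod 2) := y

/-- The observation of all channel outputs except the one at position `i`. -/
def extrinsicObs (i : ι) (y : ι → Option (ZMod 2)) : {j : ι // j ≠ i} → Option (ZMod 2) :=
  fun j => y j

end Coding

/-! Let h(p) be the probability that a bit of RM(n,r) is not determined by the unerased bits among
the others, when each position is erased with probability p. Affine symmetry makes h independent of
the bit. If the bit is determined, the MAP decoder is right, so it suffices that h(ε) be small
(`bitMAPErrorProb_le`).

The area theorem says that ∫ h over [0,1] is the rate. It comes from Russo's formula applied to the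
dimension of the subcode supported on the erasures. Hence, if h jumps sharply from 0 to 1, the jump
is near 1 - R.

Sharpness comes from comparing RM(n,r) with RM(n+k,r). The longer code restricts to RM(n,r) on every
n-dimensional subspace. Take two such subspaces that meet in dimension n - k. If the bit at the
origin is unrecoverable in the long code, it is unrecoverable in both looks, and these are
independent given the erasures on the intersection. So the failure probability of the long code is
at most h² plus the variance of a conditional expectation. Efron–Stein bounds this variance by the
influences of the intersection. Since GL(n,2) is transitive on nonzero vectors, these are at most a
fraction 2^(-k) of the total influence h'. This is `extrinsicFailure_add_le`.

Integrating over p gives ∫ h(1 - h) ≤ (rate of RM(n,r)) - (rate of RM(n+k,r)) + 2^(-k). By Pascal's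
rule and a bound on binomial coefficients the rate difference is at most k/√n. For k large and then
n large the integral is small, and monotonicity of h turns this into a bound at ε
(`lt_of_integral_mul_lt`). -/

/-! ### Product Bernoulli measures on the cube: Russo's formula and the Efron–Stein inequality. -/

section BernoulliMean

/-- The probability that a Bernoulli variable of parameter `p` takes the value `b`. -/
def bernoulliWeight (p : ℝ) (b : Bool) : ℝ := if b then p else 1 - p

/-- The expectation of `F` when its arguments are independent Bernoulli variables. -/
def bernoulliMean {ι : Type*} [Fintype ι] [DecidableEq ι] (p : ℝ) (F : (ι → Bool) → ℝ) : ℝ :=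
  ∑ ω, (∏ j, bernoulliWeight p (ω j)) * F ω

/-- The discrete derivative of `F` in the coordinate `j`. -/
def discreteDeriv {ι : Type*} [DecidableEq ι] (j : ι) (F : (ι → Bool) → ℝ) (ω : ι → Bool) : ℝ :=
  F (Function.update ω j true) - F (Function.update ω j false)

section

variable {α β : Type*} [DecidableEq α] [DecidableEq β]

/-- A pattern on `Option α`, from its value at `none` and its restriction to `α`. -/
def optionCons (b : Bool) (s : α → Bool) : Option α → Bool := fun o => o.elim b s

/-- Russo's formula and Efron–Stein are proved by induction on the index type, adding one coordinate
`none` at a time. This lemma and the next three say how derivatives behave under that splitting,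
under reindexing and under averaging over `none`. -/
lemma discreteDeriv_none (F : (Option α → Bool) → ℝ) (b : Bool) (s : α → Bool) :
    discreteDeriv none F (optionCons b s) =
      F (optionCons true s) - F (optionCons false s) := by
  have : ∀ c, Function.update (optionCons b s) none c = optionCons c s := by
    intro c; funext o; cases o <;> simp [optionCons]
  simp [discreteDeriv, this]

lemma discreteDeriv_some (F : (Option α → Bool) → ℝ) (b : Bool) (s : α → Bool) (j : α) :
    discreteDeriv (some j) F (optionCons b s) =
      discreteDeriv j (fun s => F (optionCons b s)) s := by
  have : ∀ c, Function.update (optionCons b s) (some j) c =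
      optionCons b (Function.update s j c) := by
    intro c; funext o
    rcases o with _ | a
    · simp [optionCons]
    · by_cases h : a = j <;> simp [optionCons, Function.update, h]
  simp [discreteDeriv, this]

lemma discreteDeriv_equiv (e : α ≃ β) (F : (α → Bool) → ℝ) (j : β) (ω : β → Bool) :
    discreteDeriv j (fun ω : β → Bool => F (ω ∘ e)) ω =
      discreteDeriv (e.symm j) F (ω ∘ e) := by
  have : ∀ c, Function.update ω j c ∘ e = Function.update (ω ∘ e) (e.symm j) c := by
    intro c
    rw [Function.update_comp_equiv]
  simp [discreteDeriv, this]

lemma discreteDeriv_bernoulliMean_option (p : ℝ) (F : (Option α → Bool) → ℝ) (j : α) (s : α → Bool) :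
    discreteDeriv j (fun s => p * F (optionCons true s) + (1 - p) * F (optionCons false s)) s =
      p * discreteDeriv j (fun s => F (optionCons true s)) s +
      (1 - p) * discreteDeriv j (fun s => F (optionCons false s)) s := by
  simp only [discreteDeriv]; ring

end

variable {α β ι : Type*} [Fintype α] [DecidableEq α] [Fintype β] [DecidableEq β]
  [Fintype ι] [DecidableEq ι] {p : ℝ}

lemma sum_bernoulliWeight (p : ℝ) : ∑ b, bernoulliWeight p b = 1 := by
  simp [bernoulliWeight]

lemma bernoulliWeight_nonneg (h0 : 0 ≤ p) (h1 : p ≤ 1) (b : Bool) : 0 ≤ bernoulliWeight p b := by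
  cases b <;> simp [bernoulliWeight, h0, h1]

lemma bernoulliMean_const (p c : ℝ) : bernoulliMean p (fun _ : ι → Bool => c) = c := by
  have h := Finset.prod_univ_sum (fun _ : ι => (Finset.univ : Finset Bool))
    (fun _ b => bernoulliWeight p b)
  simp only [sum_bernoulliWeight, Finset.prod_const_one, Fintype.piFinset_univ] at h
  rw [bernoulliMean, ← Finset.sum_mul, ← h, one_mul]

lemma bernoulliMean_add (F G : (ι → Bool) → ℝ) :
    bernoulliMean p (fun ω => F ω + G ω) = bernoulliMean p F + bernoulliMean p G := by
  simp only [bernoulliMean, mul_add, Finset.sum_add_distrib]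

lemma bernoulliMean_sub (F G : (ι → Bool) → ℝ) :
    bernoulliMean p (fun ω => F ω - G ω) = bernoulliMean p F - bernoulliMean p G := by
  simp only [bernoulliMean, mul_sub, Finset.sum_sub_distrib]

lemma bernoulliMean_const_mul (c : ℝ) (F : (ι → Bool) → ℝ) :
    bernoulliMean p (fun ω => c * F ω) = c * bernoulliMean p F := by
  simp only [bernoulliMean, Finset.mul_sum]
  exact Finset.sum_congr rfl fun _ _ => by ring

lemma bernoulliMean_mul_const (c : ℝ) (F : (ι → Bool) → ℝ) :
    bernoulliMean p (fun ω => F ω * c) = bernoulliMean p F * c := by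
  simp only [mul_comm _ c, bernoulliMean_const_mul]

lemma bernoulliMean_mono (h0 : 0 ≤ p) (h1 : p ≤ 1) {F G : (ι → Bool) → ℝ} (h : ∀ ω, F ω ≤ G ω) :
    bernoulliMean p F ≤ bernoulliMean p G :=
  Finset.sum_le_sum fun ω _ => mul_le_mul_of_nonneg_left (h ω)
    (Finset.prod_nonneg fun _ _ => bernoulliWeight_nonneg h0 h1 _)

lemma bernoulliMean_nonneg (h0 : 0 ≤ p) (h1 : p ≤ 1) {F : (ι → Bool) → ℝ} (h : ∀ ω, 0 ≤ F ω) :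
    0 ≤ bernoulliMean p F := by
  simpa only [bernoulliMean_const] using bernoulliMean_mono h0 h1 h

lemma bernoulliMean_le_one (h0 : 0 ≤ p) (h1 : p ≤ 1) {F : (ι → Bool) → ℝ} (h : ∀ ω, F ω ≤ 1) :
    bernoulliMean p F ≤ 1 := by
  simpa only [bernoulliMean_const] using bernoulliMean_mono h0 h1 h

lemma bernoulliMean_equiv (e : α ≃ β) (F : (α → Bool) → ℝ) :
    bernoulliMean p (fun ω : β → Bool => F (ω ∘ e)) = bernoulliMean p F := by
  refine Fintype.sum_equiv (e.symm.arrowCongr (Equiv.refl Bool)) _ _ fun ω => ?_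
  have : (e.symm.arrowCongr (Equiv.refl Bool)) ω = ω ∘ e := by ext; simp [Equiv.arrowCongr]
  rw [this, ← Equiv.prod_comp e]
  rfl

lemma bernoulliMean_sum (F : (α ⊕ β → Bool) → ℝ) :
    bernoulliMean p F =
      bernoulliMean p (fun s : α → Bool =>
        bernoulliMean p (fun t : β → Bool => F (Sum.elim s t))) := by
  simp only [bernoulliMean, Finset.mul_sum]
  rw [← Fintype.sum_prod_type']
  refine Fintype.sum_equiv (Equiv.sumArrowEquivProdArrow α β Bool) _ _ fun ω => ?_
  have : Sum.elim (ω ∘ Sum.inl) (ω ∘ Sum.inr) = ω := Sum.elim_comp_inl_inr ω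
  simp only [Fintype.prod_sum_type, Equiv.sumArrowEquivProdArrow, Equiv.coe_fn_mk, this]
  simp [mul_assoc]

/-- Coordinates outside the range of an injection do not matter. -/
lemma bernoulliMean_comp_injective {e : α → β} (he : Function.Injective e)
    (F : (α → Bool) → ℝ) :
    bernoulliMean p (fun ω : β → Bool => F (ω ∘ e)) = bernoulliMean p F := by
  classical
  let σ : α ⊕ {b // b ∉ Set.range e} ≃ β :=
    ((Equiv.ofInjective e he).sumCongr (Equiv.refl _)).trans (Equiv.Set.sumCompl (Set.range e))
  rw [← bernoulliMean_equiv σ.symm, bernoulliMean_sum]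
  congr 1
  funext s
  rw [← bernoulliMean_const (ι := {b // b ∉ Set.range e}) p (F s)]
  congr 1
  funext t
  congr 1
  funext a
  have : σ.symm (e a) = Sum.inl a := by
    rw [Equiv.symm_apply_eq]; rfl
  simp [this]

lemma bernoulliMean_option (F : (Option α → Bool) → ℝ) :
    bernoulliMean p F = p * bernoulliMean p (fun s : α → Bool => F (optionCons true s)) +
      (1 - p) * bernoulliMean p (fun s : α → Bool => F (optionCons false s)) := by
  have h : bernoulliMean p F = ∑ x : Bool × (α → Bool),
      bernoulliWeight p x.1 * ((∏ j, bernoulliWeight p (x.2 j)) * F (optionCons x.1 x.2)) := by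
    refine Fintype.sum_equiv (Equiv.piOptionEquivProd (β := fun _ : Option α => Bool)) _ _ ?_
    intro ω
    have : optionCons (ω none) (fun a => ω (some a)) = ω := by
      funext o; cases o <;> rfl
    simp [Fintype.prod_option, Equiv.piOptionEquivProd, this, mul_assoc]
  rw [h, Fintype.sum_prod_type, Fintype.sum_bool]
  simp [bernoulliMean, bernoulliWeight, Finset.mul_sum]

/-- Russo's formula. -/
theorem hasDerivAt_bernoulliMean (F : (ι → Bool) → ℝ) (p : ℝ) :
    HasDerivAt (fun p => bernoulliMean p F) (∑ j, bernoulliMean p (discreteDeriv j F)) p := by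
  classical
  -- The induction principle carries only a `Fintype` instance, so decidability is quantified inside
  -- the motive; `convert` later reconciles the instances.
  let P : (α : Type _) → [Fintype α] → Prop := fun α _ => ∀ [DecidableEq α] (F : (α → Bool) → ℝ),
    HasDerivAt (fun p => bernoulliMean p F) (∑ j, bernoulliMean p (discreteDeriv j F)) p
  have : P ι := by
    refine Fintype.induction_empty_option (P := P) ?_ ?_ ?_ ι
    · intro α β _ e h _ F
      let : Fintype α := Fintype.ofEquiv β e.symm
      let : DecidableEq α := Classical.decEq α
      have := h (fun ω => F (ω ∘ e.symm))
      simp only [bernoulliMean_equiv] at this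
      convert this using 1
      rw [← Equiv.sum_comp e]
      refine Finset.sum_congr rfl fun j _ => ?_
      rw [← bernoulliMean_equiv e.symm]
      congr 1
      funext ω
      rw [discreteDeriv_equiv]
      simp
    · intro _ F
      simp only [bernoulliMean, Finset.univ_eq_empty, Finset.prod_empty, Finset.sum_empty]
      exact hasDerivAt_const _ _
    · intro α _ h _ F
      let : DecidableEq α := Classical.decEq α
      have e : ∀ p, bernoulliMean p F =
          p * bernoulliMean p (fun s : α → Bool => F (optionCons true s)) +
          (1 - p) * bernoulliMean p (fun s : α → Bool => F (optionCons false s)) := by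
        intro p; convert bernoulliMean_option F
      simp only [e]
      have h1 := (hasDerivAt_id p).mul (h (fun s => F (optionCons true s)))
      have h0 := ((hasDerivAt_id p).const_sub 1).mul (h (fun s => F (optionCons false s)))
      -- In the product rule, differentiating the weights p and 1 - p yields the derivative at
      -- `none`; differentiating the means yields those at the other coordinates.
      refine (h1.add h0).congr_deriv ?_
      rw [Fintype.sum_option]
      have e2 : ∀ G : (Option α → Bool) → ℝ, bernoulliMean p G =
          p * bernoulliMean p (fun s : α → Bool => G (optionCons true s)) +
          (1 - p) * bernoulliMean p (fun s : α → Bool => G (optionCons false s)) := by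
        intro p; convert bernoulliMean_option _
      have e3 : ∀ j : α, bernoulliMean p (discreteDeriv (some j) F) =
          p * bernoulliMean p (discreteDeriv j fun s => F (optionCons true s)) +
          (1 - p) * bernoulliMean p (discreteDeriv j fun s => F (optionCons false s)) := by
        intro j
        rw [e2]
        congr 3 <;> funext s <;> convert discreteDeriv_some F _ s j
      have e4 : bernoulliMean p (discreteDeriv none F) =
          bernoulliMean p (fun s : α → Bool => F (optionCons true s)) -
          bernoulliMean p (fun s : α → Bool => F (optionCons false s)) := by
        have : ∀ b, (fun s : α → Bool => discreteDeriv none F (optionCons b s)) =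
            fun s => F (optionCons true s) - F (optionCons false s) := by
          intro b; funext s; convert discreteDeriv_none F b s
        rw [e2, this, this, bernoulliMean_sub]
        ring
      simp only [e3, e4, Finset.sum_add_distrib, ← Finset.mul_sum, id]
      ring
  exact this F

/-- The Efron–Stein inequality. -/
theorem bernoulliMean_sq_le (h0 : 0 ≤ p) (h1 : p ≤ 1) (F : (ι → Bool) → ℝ) :
    bernoulliMean p (fun ω => F ω ^ 2) ≤ bernoulliMean p F ^ 2 +
      p * (1 - p) * ∑ j, bernoulliMean p (fun ω => discreteDeriv j F ω ^ 2) := by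
  classical
  let P : (α : Type _) → [Fintype α] → Prop := fun α _ => ∀ [DecidableEq α] (F : (α → Bool) → ℝ),
    bernoulliMean p (fun ω => F ω ^ 2) ≤ bernoulliMean p F ^ 2 +
      p * (1 - p) * ∑ j, bernoulliMean p (fun ω => discreteDeriv j F ω ^ 2)
  have hp : 0 ≤ p * (1 - p) := mul_nonneg h0 (by linarith)
  have : P ι := by
    refine Fintype.induction_empty_option (P := P) ?_ ?_ ?_ ι
    · intro α β _ e h _ F
      let : Fintype α := Fintype.ofEquiv β e.symm
      let : DecidableEq α := Classical.decEq α
      have := h (fun ω => F (ω ∘ e.symm))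
      rw [bernoulliMean_equiv e.symm F, bernoulliMean_equiv e.symm (fun ω => F ω ^ 2)] at this
      convert this using 3
      rw [← Equiv.sum_comp e]
      refine Finset.sum_congr rfl fun j _ => ?_
      rw [← bernoulliMean_equiv e.symm]
      congr 1
      funext ω
      rw [discreteDeriv_equiv]
      simp
    · intro _ F
      simp [bernoulliMean]
    · intro α _ h _ F
      let : DecidableEq α := Classical.decEq α
      have e2 : ∀ G : (Option α → Bool) → ℝ, bernoulliMean p G =
          p * bernoulliMean p (fun s : α → Bool => G (optionCons true s)) +
          (1 - p) * bernoulliMean p (fun s : α → Bool => G (optionCons false s)) := by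
        intro p; convert bernoulliMean_option _
      -- The induction hypothesis is used for F averaged over the coordinate `none`.
      have ih := h (fun s => p * F (optionCons true s) + (1 - p) * F (optionCons false s))
      have e3 : ∀ (j : α) b, (fun s => discreteDeriv (some j) F (optionCons b s) ^ 2) =
          fun s => discreteDeriv j (fun s => F (optionCons b s)) s ^ 2 := by
        intro j b
        funext s; congr 1; convert discreteDeriv_some F _ s j
      have e4 : ∀ b, (fun s : α → Bool => discreteDeriv none F (optionCons b s) ^ 2) =
            fun s => (F (optionCons true s) - F (optionCons false s)) ^ 2 := by
          intro b; funext s; congr 1; convert discreteDeriv_none F b s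
      -- The square of a two-point mean is the mean square minus the variance p(1 - p)(difference)²,
      -- which is the `none` term of the claim.
      have e5 : bernoulliMean p (fun s : α → Bool =>
          (p * F (optionCons true s) + (1 - p) * F (optionCons false s)) ^ 2) =
          bernoulliMean p (fun ω => F ω ^ 2) - p * (1 - p) *
            bernoulliMean p (fun s => (F (optionCons true s) - F (optionCons false s)) ^ 2) := by
        rw [e2, ← bernoulliMean_const_mul, ← bernoulliMean_const_mul, ← bernoulliMean_const_mul,
          ← bernoulliMean_add, ← bernoulliMean_sub]
        congr 1; funext s; ring
      -- Convexity of the square: averaging over `none` before squaring a derivative can only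
      -- decrease it.
      have e6 : ∀ j : α, bernoulliMean p (fun s => discreteDeriv j (fun s =>
          p * F (optionCons true s) + (1 - p) * F (optionCons false s)) s ^ 2) ≤
          bernoulliMean p (fun ω => discreteDeriv (some j) F ω ^ 2) := by
        intro j
        rw [e2 (fun ω => discreteDeriv (some j) F ω ^ 2), e3, e3, ← bernoulliMean_const_mul,
          ← bernoulliMean_const_mul, ← bernoulliMean_add]
        refine bernoulliMean_mono h0 h1 fun s => ?_
        rw [discreteDeriv_bernoulliMean_option]
        set x := discreteDeriv j (fun s => F (optionCons true s)) s
        set y := discreteDeriv j (fun s => F (optionCons false s)) s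
        nlinarith [mul_nonneg hp (sq_nonneg (x - y))]
      have e7 := mul_le_mul_of_nonneg_left (Finset.sum_le_sum fun j (_ : j ∈ Finset.univ) => e6 j) hp
      rw [e5, bernoulliMean_add, bernoulliMean_const_mul, bernoulliMean_const_mul, ← e2] at ih
      rw [Fintype.sum_option, e2 (fun ω => discreteDeriv none F ω ^ 2), e4, e4]
      nlinarith
  exact this F

end BernoulliMean

/-! ### Erasure decoding of a general linear code and the area theorem. -/

section ErasureDecoding

variable {ι κ : Type*}

/-- The bit at position `i` is not determined by the other bits that are not erased, for the
pattern `ω` of erasures. -/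
def IsUnrecoverable (C : Submodule (ZMod 2) (ι → ZMod 2)) (i : ι) (ω : ι → Bool) : Prop :=
  ∃ c ∈ C, c i ≠ 0 ∧ ∀ j, j ≠ i → ω j = false → c j = 0

open scoped Classical in
/-- The indicator function of the erasure patterns for which position `i` is unrecoverable. -/
noncomputable def unrecoverableIndicator (C : Submodule (ZMod 2) (ι → ZMod 2)) (i : ι)
    (ω : ι → Bool) : ℝ :=
  if IsUnrecoverable C i ω then 1 else 0

variable (C : Submodule (ZMod 2) (ι → ZMod 2)) (i : ι)

lemma unrecoverableIndicator_nonneg (ω : ι → Bool) : 0 ≤ unrecoverableIndicator C i ω := by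
  unfold unrecoverableIndicator; split_ifs <;> norm_num

lemma unrecoverableIndicator_le_one (ω : ι → Bool) : unrecoverableIndicator C i ω ≤ 1 := by
  unfold unrecoverableIndicator; split_ifs <;> norm_num

lemma IsUnrecoverable.mono {C : Submodule (ZMod 2) (ι → ZMod 2)} {i : ι} {ω ω' : ι → Bool}
    (h : IsUnrecoverable C i ω) (hle : ∀ j, ω' j = false → ω j = false) :
    IsUnrecoverable C i ω' := by
  obtain ⟨c, hc, hi, h⟩ := h
  exact ⟨c, hc, hi, fun j hj hω => h j hj (hle j hω)⟩

/-- A codeword that witnesses the ambiguity restricts to such a witness, so whatever a sub-block can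
recover, the whole code can. -/
lemma IsUnrecoverable.comp {C : Submodule (ZMod 2) (ι → ZMod 2)}
    {D : Submodule (ZMod 2) (κ → ZMod 2)} {φ : κ → ι} (hφ : Function.Injective φ)
    (hCD : ∀ c ∈ C, c ∘ φ ∈ D) {k : κ} {ω : ι → Bool} (h : IsUnrecoverable C (φ k) ω) :
    IsUnrecoverable D k (ω ∘ φ) := by
  obtain ⟨c, hc, hi, h⟩ := h
  exact ⟨c ∘ φ, hCD c hc, hi, fun j hj hω => h (φ j) (hφ.ne hj) hω⟩

lemma unrecoverableIndicator_le_comp {C : Submodule (ZMod 2) (ι → ZMod 2)}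
    {D : Submodule (ZMod 2) (κ → ZMod 2)} {φ : κ → ι} (hφ : Function.Injective φ)
    (hCD : ∀ c ∈ C, c ∘ φ ∈ D) (k : κ) (ω : ι → Bool) :
    unrecoverableIndicator C (φ k) ω ≤ unrecoverableIndicator D k (ω ∘ φ) := by
  by_cases h : IsUnrecoverable C (φ k) ω
  · rw [unrecoverableIndicator, unrecoverableIndicator, if_pos h, if_pos (h.comp hφ hCD)]
  · rw [unrecoverableIndicator, if_neg h]
    exact unrecoverableIndicator_nonneg _ _ _

/-- Each of the two inclusions yields one of the two inequalities. -/
lemma unrecoverableIndicator_comp_equiv {σ : ι ≃ ι} (h1 : ∀ c ∈ C, c ∘ σ ∈ C)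
    (h2 : ∀ c ∈ C, c ∘ σ.symm ∈ C) (ω : ι → Bool) :
    unrecoverableIndicator C i (ω ∘ σ) = unrecoverableIndicator C (σ i) ω := by
  refine le_antisymm ?_ (unrecoverableIndicator_le_comp σ.injective h1 i ω)
  have := unrecoverableIndicator_le_comp σ.symm.injective h2 (σ i) (ω ∘ σ)
  simpa [Function.comp_assoc] using this

/-- The codewords supported in the erased positions. -/
def erasedSubcode (ω : ι → Bool) : Submodule (ZMod 2) (ι → ZMod 2) where
  carrier := {c | c ∈ C ∧ ∀ j, ω j = false → c j = 0}
  add_mem' := fun ha hb => ⟨C.add_mem ha.1 hb.1, fun j hj => by simp [ha.2 j hj, hb.2 j hj]⟩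
  zero_mem' := ⟨C.zero_mem, fun _ _ => rfl⟩
  smul_mem' := fun a _ hc => ⟨C.smul_mem a hc.1, fun j hj => by simp [hc.2 j hj]⟩

lemma mem_erasedSubcode {ω : ι → Bool} {c : ι → ZMod 2} :
    c ∈ erasedSubcode C ω ↔ c ∈ C ∧ ∀ j, ω j = false → c j = 0 := Iff.rfl

section

variable [Fintype ι]

lemma becTransition_nonneg {ε : ℝ} (h0 : 0 ≤ ε) (h1 : ε ≤ 1) (x : ZMod 2) (y : Option (ZMod 2)) :
    0 ≤ becTransition ε x y := by
  rcases y with _ | b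
  · exact h0
  · simp only [becTransition]; split_ifs <;> linarith

lemma jointProb_nonneg {ε : ℝ} (h0 : 0 ≤ ε) (h1 : ε ≤ 1) (x : ι → ZMod 2)
    (y : ι → Option (ZMod 2)) : 0 ≤ jointProb C ε x y := by
  refine mul_nonneg ?_ (Finset.prod_nonneg fun _ _ => becTransition_nonneg h0 h1 _ _)
  split_ifs <;> positivity

lemma mem_of_jointProb_ne_zero {ε : ℝ} {x : ι → ZMod 2} {y : ι → Option (ZMod 2)}
    (h : jointProb C ε x y ≠ 0) : x ∈ C ∧ ∀ j b, y j = some b → b = x j := by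
  rw [jointProb, mul_ne_zero_iff, Finset.prod_ne_zero_iff] at h
  refine ⟨by_contra fun hx => h.1 (if_neg hx), fun j b hb => by_contra fun hne => ?_⟩
  exact h.2 j (Finset.mem_univ j) (by simp [becTransition, hb, hne])

end

variable [DecidableEq ι]

/-- Further erasures keep every witness of ambiguity. -/
lemma discreteDeriv_unrecoverableIndicator_nonneg (j : ι) (ω : ι → Bool) :
    0 ≤ discreteDeriv j (unrecoverableIndicator C i) ω := by
  rw [discreteDeriv, sub_nonneg]
  by_cases h : IsUnrecoverable C i (Function.update ω j false)
  · have h' : IsUnrecoverable C i (Function.update ω j true) := h.mono fun l hl => by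
      by_cases e : l = j
      · subst e; simp
      · simpa [Function.update, e] using hl
    rw [unrecoverableIndicator, unrecoverableIndicator, if_pos h, if_pos h']
  · rw [unrecoverableIndicator, if_neg h]
    exact unrecoverableIndicator_nonneg _ _ _

lemma discreteDeriv_unrecoverableIndicator_le_one (j : ι) (ω : ι → Bool) :
    discreteDeriv j (unrecoverableIndicator C i) ω ≤ 1 := by
  rw [discreteDeriv]
  linarith [unrecoverableIndicator_le_one C i (Function.update ω j true),
    unrecoverableIndicator_nonneg C i (Function.update ω j false)]

/-- The condition on a witness exempts the position i, so its own erasure is irrelevant. -/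
lemma discreteDeriv_unrecoverableIndicator_self (ω : ι → Bool) :
    discreteDeriv i (unrecoverableIndicator C i) ω = 0 := by
  have : IsUnrecoverable C i (Function.update ω i true) ↔
      IsUnrecoverable C i (Function.update ω i false) := by
    unfold IsUnrecoverable
    refine exists_congr fun c => and_congr_right fun _ => and_congr_right fun _ =>
      forall_congr' fun j => forall_congr' fun hj => ?_
    simp [Function.update, hj]
  by_cases h : IsUnrecoverable C i (Function.update ω i false)
  · rw [discreteDeriv, unrecoverableIndicator, unrecoverableIndicator, if_pos h,
      if_pos (this.2 h), sub_self]
  · rw [discreteDeriv, unrecoverableIndicator, unrecoverableIndicator, if_neg h,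
      if_neg (this.not.2 h), sub_self]

lemma mem_erasedSubcode_update_false {ω : ι → Bool} {c : ι → ZMod 2} :
    c ∈ erasedSubcode C (Function.update ω i false) ↔
      c ∈ erasedSubcode C (Function.update ω i true) ∧ c i = 0 := by
  simp only [mem_erasedSubcode, and_assoc]
  refine and_congr_right fun _ => ⟨fun h => ⟨fun j hj => ?_, h i (by simp)⟩, fun h j hj => ?_⟩
  · by_cases e : j = i
    · subst e; simp at hj
    · exact h j (by simpa [Function.update, e] using hj)
  · by_cases e : j = i
    · subst e; exact h.2
    · exact h.1 j (by simpa [Function.update, e] using hj)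

/-- Erasing position i lifts the single linear constraint c i = 0. The dimension grows by one
precisely when some codeword supported on the erasures is nonzero at i. This is what makes the
failure probabilities the terms of a Russo derivative. -/
lemma discreteDeriv_finrank_erasedSubcode [Finite ι] (ω : ι → Bool) :
    discreteDeriv i (fun ω => (Module.finrank (ZMod 2) (erasedSubcode C ω) : ℝ)) ω =
      unrecoverableIndicator C i ω := by
  set U := erasedSubcode C (Function.update ω i true) with hU
  set W := erasedSubcode C (Function.update ω i false) with hW
  have hWU : ∀ c, c ∈ W ↔ c ∈ U ∧ c i = 0 := fun c => mem_erasedSubcode_update_false C i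
  have hiff : IsUnrecoverable C i ω ↔ ∃ c ∈ U, c i ≠ 0 := by
    refine exists_congr fun c => ⟨fun h => ⟨⟨h.1, fun j hj => ?_⟩, h.2.1⟩,
      fun h => ⟨h.1.1, h.2, fun j hj hω => h.1.2 j (by simpa [Function.update, hj] using hω)⟩⟩
    by_cases e : j = i
    · subst e; simp at hj
    · exact h.2.2 j e (by simpa [Function.update, e] using hj)
  change (Module.finrank (ZMod 2) U : ℝ) - (Module.finrank (ZMod 2) W : ℝ) = _
  by_cases h : ∃ c ∈ U, c i ≠ 0
  · rw [unrecoverableIndicator, if_pos (hiff.2 h)]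
    obtain ⟨c, hc, hci⟩ := h
    -- Rank–nullity for evaluation at i: it is onto the field, and its kernel is W.
    let L : U →ₗ[ZMod 2] ZMod 2 := (LinearMap.proj i).comp U.subtype
    have hL : L ≠ 0 := fun h0 => hci (by simpa [L] using LinearMap.congr_fun h0 ⟨c, hc⟩)
    have hrange := LinearMap.range_eq_top.2 (LinearMap.surjective hL)
    have hrk := L.finrank_range_add_finrank_ker
    rw [hrange, finrank_top, Module.finrank_self] at hrk
    have hker : (L.ker).map U.subtype = W := by
      ext x
      simp only [Submodule.mem_map, LinearMap.mem_ker, hWU]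
      constructor
      · rintro ⟨y, hy, rfl⟩; exact ⟨y.2, hy⟩
      · rintro ⟨hx, h0⟩; exact ⟨⟨x, hx⟩, h0, rfl⟩
    have : Module.finrank (ZMod 2) L.ker = Module.finrank (ZMod 2) W := by
      rw [← hker]
      exact (LinearEquiv.finrank_eq (Submodule.equivMapOfInjective _ U.injective_subtype _))
    rw [← this, ← hrk]
    push_cast; ring
  · rw [unrecoverableIndicator, if_neg (hiff.not.2 h)]
    push Not at h
    have : U = W := by
      ext c; rw [hWU]; exact ⟨fun hc => ⟨hc, h c hc⟩, fun hc => hc.1⟩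
    rw [this, sub_self]

variable [Fintype ι]

lemma continuous_bernoulliMean (F : (ι → Bool) → ℝ) :
    Continuous fun p => bernoulliMean p F :=
  continuous_iff_continuousAt.2 fun p => (hasDerivAt_bernoulliMean F p).continuousAt

lemma bernoulliMean_zero (F : (ι → Bool) → ℝ) : bernoulliMean 0 F = F fun _ => false := by
  rw [bernoulliMean, Fintype.sum_eq_single (fun _ => false)]
  · simp [bernoulliWeight]
  · intro ω hω
    obtain ⟨j, hj⟩ := Function.ne_iff.1 hω
    rw [Finset.prod_eq_zero (Finset.mem_univ j), zero_mul]
    simpa [bernoulliWeight] using hj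

lemma bernoulliMean_one (F : (ι → Bool) → ℝ) : bernoulliMean 1 F = F fun _ => true := by
  rw [bernoulliMean, Fintype.sum_eq_single (fun _ => true)]
  · simp [bernoulliWeight]
  · intro ω hω
    obtain ⟨j, hj⟩ := Function.ne_iff.1 hω
    rw [Finset.prod_eq_zero (Finset.mem_univ j), zero_mul]
    simpa [bernoulliWeight] using hj

lemma integral_sum_bernoulliMean_discreteDeriv (F : (ι → Bool) → ℝ) :
    ∫ p in (0 : ℝ)..1, ∑ j, bernoulliMean p (discreteDeriv j F) =
      F (fun _ => true) - F fun _ => false := by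
  rw [intervalIntegral.integral_eq_sub_of_hasDerivAt
    (fun p _ => hasDerivAt_bernoulliMean F p), bernoulliMean_one, bernoulliMean_zero]
  exact (continuous_finsetSum _ fun j _ => continuous_bernoulliMean _).intervalIntegrable _ _

/-- The area theorem for the erasure channel. -/
theorem sum_integral_unrecoverableIndicator :
    ∑ i, ∫ p in (0 : ℝ)..1, bernoulliMean p (unrecoverableIndicator C i) =
      Module.finrank (ZMod 2) C := by
  -- The dimension of the erased subcode runs from 0 with nothing erased to dim C with everything
  -- erased.
  have h := integral_sum_bernoulliMean_discreteDeriv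
    (fun ω => (Module.finrank (ZMod 2) (erasedSubcode C ω) : ℝ))
  have e1 : erasedSubcode C (fun _ => true) = C := by
    ext; simp [mem_erasedSubcode]
  have e0 : erasedSubcode C (fun _ => false) = ⊥ := by
    ext c
    simp only [mem_erasedSubcode, forall_true_left, Submodule.mem_bot]
    exact ⟨fun h => funext h.2, fun h => by subst h; exact ⟨C.zero_mem, fun _ => rfl⟩⟩
  beta_reduce at h
  rw [e1, e0, finrank_bot, Nat.cast_zero, sub_zero] at h
  rw [← h, intervalIntegral.integral_finsetSum
    fun j _ => (continuous_bernoulliMean _).intervalIntegrable _ _]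
  refine Finset.sum_congr rfl fun j _ => ?_
  congr 1
  funext p
  congr 1
  funext ω
  exact (discreteDeriv_finrank_erasedSubcode C j ω).symm

/-! ### From unrecoverability to the error probability of the bit-MAP decoder. -/

lemma jointProb_le_eventProb {ε : ℝ} (h0 : 0 ≤ ε) (h1 : ε ≤ 1)
    {E : (ι → ZMod 2) → (ι → Option (ZMod 2)) → Prop} {x : ι → ZMod 2}
    {y : ι → Option (ZMod 2)} (h : E x y) : jointProb C ε x y ≤ eventProb C ε E := by
  classical
  have hn : ∀ x y, 0 ≤ if E x y then jointProb C ε x y else 0 := by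
    intro x y
    split_ifs
    exacts [jointProb_nonneg C h0 h1 x y, le_rfl]
  unfold eventProb
  calc jointProb C ε x y = if E x y then jointProb C ε x y else 0 := (if_pos h).symm
    _ ≤ ∑ y, if E x y then jointProb C ε x y else 0 :=
      Finset.single_le_sum (f := fun y => if E x y then jointProb C ε x y else 0)
        (fun y _ => hn x y) (Finset.mem_univ y)
    _ ≤ _ := by
      refine le_trans ?_ (Finset.single_le_sum (f := fun x => ∑ y,
        if E x y then jointProb C ε x y else 0)
        (fun x _ => Finset.sum_nonneg fun y _ => hn x y) (Finset.mem_univ x))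
      exact le_of_eq (Finset.sum_congr rfl fun _ _ => by congr)

variable {β : Type*}

/-- A codeword that fits the observation but has the other bit at i would, subtracted from the true
one, witness ambiguity. So the wrong bit has posterior zero. The hypothesis `hT` covers both the
full and the extrinsic observation. -/
lemma bitMAP_eq_some {ε : ℝ} (h0 : 0 ≤ ε) (h1 : ε ≤ 1) {T : (ι → Option (ZMod 2)) → β}
    (hT : ∀ y y', T y = T y' → ∀ j, j ≠ i → y j = y' j) {x : ι → ZMod 2}
    {y : ι → Option (ZMod 2)} (hxy : jointProb C ε x y ≠ 0)
    (hrec : ¬ IsUnrecoverable C i fun j => (y j).isNone) :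
    bitMAP C ε i T (T y) = some (x i) := by
  have hpos : 0 < jointProb C ε x y := lt_of_le_of_ne (jointProb_nonneg C h0 h1 x y) hxy.symm
  have htrue : 0 < posterior C ε i T (T y) (x i) :=
    div_pos (hpos.trans_le (jointProb_le_eventProb C h0 h1 ⟨rfl, rfl⟩))
      (hpos.trans_le (jointProb_le_eventProb C h0 h1 rfl))
  have hfalse : ∀ b, b ≠ x i → posterior C ε i T (T y) b = 0 := by
    intro b hb
    refine div_eq_zero_iff.2 (Or.inl ?_)
    refine Finset.sum_eq_zero fun x' _ => Finset.sum_eq_zero fun y' _ => ?_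
    split_ifs with hE
    swap
    · rfl
    obtain ⟨hx', hy'⟩ := hE
    by_contra hne
    have m := mem_of_jointProb_ne_zero C hxy
    have m' := mem_of_jointProb_ne_zero C hne
    refine hrec ⟨x - x', C.sub_mem m.1 m'.1, ?_, fun j hj hn => ?_⟩
    · rw [Pi.sub_apply, hx', sub_ne_zero]; exact hb.symm
    · obtain ⟨a, ha⟩ := Option.isSome_iff_exists.1 (by simpa using hn : (y j).isSome)
      rw [Pi.sub_apply, ← m.2 j a ha, ← m'.2 j a ((hT _ _ hy' j hj).trans ha), sub_self]
  have hcases : ∀ b : ZMod 2, b = 0 ∨ b = 1 := by decide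
  unfold bitMAP
  rcases hcases (x i) with hb | hb
  · rw [hb] at htrue hfalse ⊢
    rw [hfalse 1 (by decide), if_pos htrue]
  · rw [hb] at htrue hfalse ⊢
    rw [hfalse 0 (by decide), if_neg htrue.le.not_gt, if_pos htrue]

/-- The erasure pattern is a Bernoulli vector whatever the transmitted word: given x, exactly one
unerased symbol has positive weight at each position. -/
lemma sum_prod_becTransition (ε : ℝ) (x : ι → ZMod 2) (F : (ι → Bool) → ℝ) :
    ∑ y : ι → Option (ZMod 2), (∏ j, becTransition ε (x j) (y j)) * F (fun j => (y j).isNone) =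
      bernoulliMean ε F := by
  classical
  rw [← Finset.sum_fiberwise (g := fun (y : ι → Option (ZMod 2)) j => (y j).isNone)]
  refine Finset.sum_congr rfl fun ω _ => ?_
  have hfib : ({y : ι → Option (ZMod 2) | (fun j => (y j).isNone) = ω} : Finset _) =
      Fintype.piFinset fun j => ({a | a.isNone = ω j} : Finset (Option (ZMod 2))) := by
    ext y; simp [funext_iff]
  have hw : ∀ j, ∑ a ∈ ({a | a.isNone = ω j} : Finset (Option (ZMod 2))),
      becTransition ε (x j) a = bernoulliWeight ε (ω j) := by
    intro j
    rw [Finset.sum_filter, Fintype.sum_option]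
    cases ω j <;> simp [becTransition, bernoulliWeight]
  rw [Finset.sum_congr rfl (g := fun y => (∏ j, becTransition ε (x j) (y j)) * F ω),
    ← Finset.sum_mul, hfib, ← Finset.prod_univ_sum]
  · simp only [hw]
  · intro y hy
    rw [(Finset.mem_filter.1 hy).2]

theorem bitMAPErrorProb_le {ε : ℝ} (h0 : 0 ≤ ε) (h1 : ε ≤ 1) {T : (ι → Option (ZMod 2)) → β}
    (hT : ∀ y y', T y = T y' → ∀ j, j ≠ i → y j = y' j) :
    bitMAPErrorProb C ε i T ≤ bernoulliMean ε (unrecoverableIndicator C i) := by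
  classical
  calc bitMAPErrorProb C ε i T
      ≤ ∑ x : ι → ZMod 2, ∑ y : ι → Option (ZMod 2),
          jointProb C ε x y * unrecoverableIndicator C i fun j => (y j).isNone := by
        refine Finset.sum_le_sum fun x _ => Finset.sum_le_sum fun y _ => ?_
        have hn := jointProb_nonneg C h0 h1 x y
        have hn' := mul_nonneg hn (unrecoverableIndicator_nonneg C i fun j => (y j).isNone)
        split_ifs with h
        · by_cases hz : jointProb C ε x y = 0
          · rw [hz, zero_mul]
          · have : IsUnrecoverable C i fun j => (y j).isNone :=
              by_contra fun hr => h (bitMAP_eq_some C i h0 h1 hT hz hr)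
            rw [unrecoverableIndicator, if_pos this, mul_one]
        · exact hn'
    _ = ∑ x : ι → ZMod 2, (if x ∈ C then 1 / (Nat.card C : ℝ) else 0) *
          bernoulliMean ε (unrecoverableIndicator C i) := by
        refine Finset.sum_congr rfl fun x _ => ?_
        rw [← sum_prod_becTransition ε x, Finset.mul_sum]
        refine Finset.sum_congr rfl fun y _ => ?_
        rw [jointProb, mul_assoc]
    _ = bernoulliMean ε (unrecoverableIndicator C i) := by
        rw [← Finset.sum_mul, ← Finset.sum_filter, Finset.sum_const, nsmul_eq_mul]
        have : (Finset.univ.filter (· ∈ C)).card = Nat.card C := by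
          rw [Nat.card_eq_fintype_card, Fintype.card_subtype]
        rw [this, mul_one_div_cancel, one_mul]
        exact Nat.cast_ne_zero.2 Nat.card_pos.ne'

end ErasureDecoding

/-! ### Reed–Muller codes as polynomial codes: affine invariance, dimension and rate. -/

section ReedMuller

variable {n m r : ℕ}

/-- The function `b ↦ 1 - b j`, a generator of the affine functions. -/
def coordZero (j : Fin n) : (Fin n → Fin 2) → ZMod 2 :=
  fun b => (!![1, 0; 1, 1] : Matrix (Fin 2) (Fin 2) (ZMod 2)) 0 (b j)

/-- The affine functions on the `n`-dimensional space over the field with two elements. -/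
def affineFunctions (n : ℕ) : Submodule (ZMod 2) ((Fin n → Fin 2) → ZMod 2) :=
  Submodule.span (ZMod 2) (insert 1 (Set.range coordZero))

lemma one_mem_affineFunctions : 1 ∈ affineFunctions n :=
  Submodule.subset_span (Set.mem_insert _ _)

lemma coordZero_mem_affineFunctions (j : Fin n) : coordZero j ∈ affineFunctions n :=
  Submodule.subset_span (Set.mem_insert_of_mem _ ⟨j, rfl⟩)

/-- The positions of the zeros of an index. -/
def zeroSet (a : Fin n → Fin 2) : Finset (Fin n) := Finset.univ.filter fun j => a j = 0

lemma mem_zeroSet {a : Fin n → Fin 2} {j : Fin n} : j ∈ zeroSet a ↔ a j = 0 := by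
  simp [zeroSet]

/-- The row (1 1) contributes the constant 1 and the row (1 0) the function 1 - b j, so the rows of
the Kronecker power are monomials whose degree is the number of zeros of a. -/
lemma hadamardPow_eq_prod (a : Fin n → Fin 2) :
    hadamardPow n a = ∏ j ∈ zeroSet a, coordZero j := by
  refine funext fun b : Fin n → Fin 2 => ?_
  rw [Finset.prod_apply, zeroSet, Finset.prod_filter]
  change ∏ j, (!![1, 0; 1, 1] : Matrix (Fin 2) (Fin 2) (ZMod 2)) (a j) (b j) = _
  refine Finset.prod_congr rfl fun j _ => ?_
  have : ∀ x y : Fin 2, (!![1, 0; 1, 1] : Matrix (Fin 2) (Fin 2) (ZMod 2)) x y =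
      if x = 0 then (!![1, 0; 1, 1] : Matrix (Fin 2) (Fin 2) (ZMod 2)) 0 y else 1 := by
    intro x y
    fin_cases x <;> fin_cases y <;> rfl
  exact this _ _

/-- The support is a subcube: b j must vanish where a j does and is free elsewhere. -/
lemma hammingNorm_hadamardPow (a : Fin n → Fin 2) :
    hammingNorm (hadamardPow n a) = 2 ^ (n - (zeroSet a).card) := by
  have h1 : (Finset.univ.filter fun b => hadamardPow n a b ≠ 0) =
      Fintype.piFinset fun j => if a j = 0 then ({0} : Finset (Fin 2)) else Finset.univ := by
    ext b
    simp only [Finset.mem_filter, Finset.mem_univ, true_and, Fintype.mem_piFinset, hadamardPow,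
      Matrix.of_apply, Finset.prod_ne_zero_iff, forall_true_left]
    refine forall_congr' fun j => ?_
    generalize a j = x
    generalize b j = y
    revert x y
    decide
  rw [hammingNorm, h1, Fintype.card_piFinset]
  have h2 : ∀ j, (if a j = 0 then ({0} : Finset (Fin 2)) else Finset.univ).card =
      if a j = 0 then 1 else 2 := by
    intro j; split_ifs <;> simp
  rw [Finset.prod_congr rfl fun j _ => h2 j, Finset.prod_ite, Finset.prod_const_one, one_mul,
    Finset.prod_const]
  congr 1
  have := Finset.card_filter_add_card_filter_not (s := (Finset.univ : Finset (Fin n)))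
    (fun j => a j = 0)
  rw [Finset.card_univ, Fintype.card_fin] at this
  rw [zeroSet]
  omega

lemma pow_le_hammingNorm_hadamardPow_iff (a : Fin n → Fin 2) :
    2 ^ (n - r) ≤ hammingNorm (hadamardPow n a) ↔ (zeroSet a).card ≤ r := by
  rw [hammingNorm_hadamardPow, Nat.pow_le_pow_iff_right (by norm_num)]
  -- Needed because of the truncated subtractions from n.
  have : (zeroSet a).card ≤ n := by
    simpa using Finset.card_le_univ (zeroSet a)
  omega

lemma reedMuller_eq_span (n r : ℕ) : reedMuller n r =
    Submodule.span (ZMod 2) (hadamardPow n '' {a | (zeroSet a).card ≤ r}) := by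
  rw [reedMuller]
  congr 1
  ext v
  simp only [pow_le_hammingNorm_hadamardPow_iff]
  exact exists_congr fun a => by rw [and_comm, eq_comm]; rfl

lemma affineFunctions_pow_mono {s : ℕ} (h : r ≤ s) :
    affineFunctions n ^ r ≤ affineFunctions n ^ s := by
  induction s, h using Nat.le_induction with
  | base => exact le_rfl
  | succ s _ ih =>
    refine ih.trans fun x hx => ?_
    rw [pow_succ, ← mul_one x]
    exact Submodule.mul_mem_mul hx one_mem_affineFunctions

lemma prod_coordZero_mem (s : Finset (Fin n)) :
    ∏ j ∈ s, coordZero j ∈ affineFunctions n ^ s.card := by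
  induction s using Finset.induction_on with
  | empty => simp [Submodule.one_le.1 le_rfl]
  | insert j s hj ih =>
    rw [Finset.prod_insert hj, Finset.card_insert_of_notMem hj, pow_succ']
    exact Submodule.mul_mem_mul (coordZero_mem_affineFunctions j) ih

/-- The coordinate functions are idempotent, so a repeated factor does not leave the set of rows. -/
lemma hadamardPow_mul_coordZero (a : Fin n → Fin 2) (j : Fin n) :
    hadamardPow n a * coordZero j = hadamardPow n (Function.update a j 0) := by
  have hz : zeroSet (Function.update a j 0) = insert j (zeroSet a) := by
    ext l
    simp only [mem_zeroSet, Finset.mem_insert, Function.update_apply]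
    split_ifs with h <;> simp [h]
  rw [hadamardPow_eq_prod, hadamardPow_eq_prod, hz]
  by_cases hj : j ∈ zeroSet a
  · rw [Finset.insert_eq_of_mem hj, ← Finset.prod_erase_mul _ _ hj, mul_assoc]
    congr 1
    funext b
    have : ∀ x : Fin 2, (!![1, 0; 1, 1] : Matrix (Fin 2) (Fin 2) (ZMod 2)) 0 x *
      (!![1, 0; 1, 1] : Matrix (Fin 2) (Fin 2) (ZMod 2)) 0 x =
      (!![1, 0; 1, 1] : Matrix (Fin 2) (Fin 2) (ZMod 2)) 0 x := by decide
    exact this _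
  · rw [Finset.prod_insert hj, mul_comm]

/-- The Reed–Muller code of order `r` consists of the sums of products of `r` affine functions. -/
theorem reedMuller_eq_pow (n r : ℕ) : reedMuller n r = affineFunctions n ^ r := by
  rw [reedMuller_eq_span]
  refine le_antisymm (Submodule.span_le.2 ?_) ?_
  · rintro _ ⟨a, ha, rfl⟩
    rw [hadamardPow_eq_prod]
    exact affineFunctions_pow_mono ha (prod_coordZero_mem _)
  · induction r with
    | zero =>
      rw [pow_zero, Submodule.one_le]
      refine Submodule.subset_span ⟨fun _ => 1, ?_, ?_⟩
      · simp [zeroSet]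
      · rw [hadamardPow_eq_prod]; simp [zeroSet]
    | succ r ih =>
      rw [pow_succ]
      refine (mul_le_mul_left ih _).trans ?_
      rw [affineFunctions, Submodule.span_mul_span, Submodule.span_le]
      rintro _ ⟨_, ⟨a, ha, rfl⟩, g, rfl | ⟨j, rfl⟩, rfl⟩
      · exact Submodule.subset_span ⟨a, Nat.le_succ_of_le ha, (mul_one _).symm⟩
      · refine Submodule.subset_span ⟨Function.update a j 0, ?_,
          (hadamardPow_mul_coordZero a j).symm⟩
        have : zeroSet (Function.update a j 0) ⊆ insert j (zeroSet a) := by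
          intro l
          simp only [mem_zeroSet, Finset.mem_insert, Function.update_apply]
          split_ifs with h <;> simp [h]
        exact (Finset.card_le_card this).trans ((Finset.card_insert_le _ _).trans
          (Nat.succ_le_succ ha))

/-- Composition with a map, as a homomorphism of function algebras. -/
def compAlgHom {α β : Type*} (φ : α → β) : (β → ZMod 2) →ₐ[ZMod 2] (α → ZMod 2) :=
  AlgHom.pi fun x => Pi.evalAlgHom (ZMod 2) (fun _ => ZMod 2) (φ x)

/-- Composition with φ is an algebra homomorphism, so it carries r-th powers of the affine functions
to r-th powers. This is why the description as a power is preferred to the spanning rows. -/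
lemma comp_mem_reedMuller {φ : (Fin m → Fin 2) → (Fin n → Fin 2)}
    (hφ : ∀ j, coordZero j ∘ φ ∈ affineFunctions m) {c : (Fin n → Fin 2) → ZMod 2}
    (hc : c ∈ reedMuller n r) : c ∘ φ ∈ reedMuller m r := by
  rw [reedMuller_eq_pow] at hc ⊢
  have h1 : (affineFunctions n).map (compAlgHom φ).toLinearMap ≤ affineFunctions m := by
    rw [affineFunctions, Submodule.map_span, Submodule.span_le]
    rintro _ ⟨_, rfl | ⟨j, rfl⟩, rfl⟩
    · exact one_mem_affineFunctions
    · exact hφ j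
  have h2 : ((affineFunctions n) ^ r).map (compAlgHom φ).toLinearMap ≤ affineFunctions m ^ r := by
    rw [Submodule.map_pow]
    exact pow_le_pow_left' h1 r
  exact h2 ⟨c, hc, rfl⟩

/-- Indices are read as vectors here: `ZMod 2` unfolds to `Fin 2`. -/
lemma coordZero_apply (j : Fin n) (b : Fin n → ZMod 2) : coordZero j b = 1 - b j := by
  have : ∀ x : Fin 2, (!![1, 0; 1, 1] : Matrix (Fin 2) (Fin 2) (ZMod 2)) 0 x =
      1 - (show ZMod 2 from x) := by decide
  exact this _

lemma affine_mem_affineFunctions (a : Fin m → ZMod 2) (b : ZMod 2) :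
    (fun x : Fin m → ZMod 2 => ∑ i, a i * x i + b) ∈ affineFunctions m := by
  have h : (b • (1 : (Fin m → Fin 2) → ZMod 2) +
        ∑ i, a i • ((1 : (Fin m → Fin 2) → ZMod 2) - coordZero i)) ∈ affineFunctions m :=
    Submodule.add_mem _ (Submodule.smul_mem _ _ one_mem_affineFunctions)
      (Submodule.sum_mem _ fun i _ => Submodule.smul_mem _ _ (Submodule.sub_mem _
        one_mem_affineFunctions (coordZero_mem_affineFunctions i)))
  have e : ∀ x : Fin m → Fin 2, (b • (1 : (Fin m → Fin 2) → ZMod 2) +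
        ∑ i, a i • ((1 : (Fin m → Fin 2) → ZMod 2) - coordZero i)) x =
      ∑ i, a i * (1 - coordZero i x) + b := by
    intro x
    simp [add_comm]
  refine (congrArg (· ∈ affineFunctions m) (funext fun x => ?_)).mpr h
  rw [e]
  congr 1
  refine Finset.sum_congr rfl fun i _ => ?_
  exact congrArg (a i * ·)
    ((congrArg (1 - ·) (coordZero_apply i x)).trans (sub_sub_cancel _ _)).symm

lemma comp_affine_mem_reedMuller (A : (Fin m → ZMod 2) →ₗ[ZMod 2] (Fin n → ZMod 2))
    (v : Fin n → ZMod 2) {c : (Fin n → Fin 2) → ZMod 2} (hc : c ∈ reedMuller n r) :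
    (fun x : Fin m → ZMod 2 => c (A x + v)) ∈ reedMuller m r := by
  refine comp_mem_reedMuller (φ := fun x : Fin m → ZMod 2 => A x + v) (fun j => ?_) hc
  refine (congrArg (· ∈ affineFunctions m) (funext fun x : Fin m → ZMod 2 => ?_)).mpr
    (affine_mem_affineFunctions (fun i => -(A (Pi.single i 1) j)) (1 - v j))
  refine (coordZero_apply j (A x + v)).trans ?_
  have e : A x j = ∑ i, x i * A (Pi.single i 1) j := by
    conv_lhs => rw [pi_eq_sum_univ' x]
    simp [Finset.sum_apply]
  rw [Pi.add_apply, e]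
  simp only [neg_mul, Finset.sum_neg_distrib, mul_comm (x _)]
  ring

/-- The general linear group over the field with two elements is transitive on the nonzero
vectors. -/
lemma exists_linearEquiv_apply_eq {x y : Fin n → ZMod 2} (hx : x ≠ 0) (hy : y ≠ 0) :
    ∃ e : (Fin n → ZMod 2) ≃ₗ[ZMod 2] (Fin n → ZMod 2), e x = y := by
  have h01 : ∀ a : ZMod 2, a ≠ 0 → a = 1 := by decide
  -- With a functional equal to 1 at both vectors, the transvection v ↦ v + f(v)(y - x) sends x to
  -- y. A single coordinate serves as f, or the sum of two.
  obtain ⟨f, hfx, hfy⟩ : ∃ f : Module.Dual (ZMod 2) (Fin n → ZMod 2), f x = 1 ∧ f y = 1 := by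
    obtain ⟨j, hj⟩ := Function.ne_iff.1 hx
    obtain ⟨l, hl⟩ := Function.ne_iff.1 hy
    by_cases h1 : y j = 0
    · by_cases h2 : x l = 0
      · refine ⟨LinearMap.proj (R := ZMod 2) (φ := fun _ => ZMod 2) j +
          LinearMap.proj (R := ZMod 2) (φ := fun _ => ZMod 2) l, ?_, ?_⟩
        · simp [h2, h01 _ hj]
        · simp [h1, h01 _ hl]
      · exact ⟨LinearMap.proj l, h01 _ h2, h01 _ hl⟩
    · exact ⟨LinearMap.proj j, h01 _ hj, h01 _ h1⟩
  have h0 : f (y - x) = 0 := by rw [map_sub, hfx, hfy, sub_self]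
  exact ⟨LinearEquiv.transvection h0, by rw [LinearEquiv.transvection.apply, hfx]; simp⟩

/-- The 2 × 2 matrix is an involution in characteristic two. Invertibility makes the rows
independent, so the dimension of the code is a count of rows. -/
lemma hadamardPow_mul_self (n : ℕ) : hadamardPow n * hadamardPow n = 1 := by
  ext a c
  rw [Matrix.mul_apply]
  change ∑ b : Fin n → Fin 2,
    (∏ j, (!![1, 0; 1, 1] : Matrix (Fin 2) (Fin 2) (ZMod 2)) (a j) (b j)) *
    ∏ j, (!![1, 0; 1, 1] : Matrix (Fin 2) (Fin 2) (ZMod 2)) (b j) (c j) = _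
  simp only [← Finset.prod_mul_distrib]
  have h := Finset.prod_univ_sum (fun _ : Fin n => (Finset.univ : Finset (Fin 2)))
    (fun j b => (!![1, 0; 1, 1] : Matrix (Fin 2) (Fin 2) (ZMod 2)) (a j) b *
      (!![1, 0; 1, 1] : Matrix (Fin 2) (Fin 2) (ZMod 2)) b (c j))
  rw [Fintype.piFinset_univ] at h
  rw [← h]
  have h2 : ∀ x y : Fin 2, ∑ b, (!![1, 0; 1, 1] : Matrix (Fin 2) (Fin 2) (ZMod 2)) x b *
      (!![1, 0; 1, 1] : Matrix (Fin 2) (Fin 2) (ZMod 2)) b y = if x = y then 1 else 0 := by decide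
  simp only [h2, Matrix.one_apply, funext_iff]
  rw [Finset.prod_ite_zero]
  simp

lemma card_zeroSet_le (n r : ℕ) : Fintype.card {a : Fin n → Fin 2 // (zeroSet a).card ≤ r} =
    ∑ i ∈ Finset.range (r + 1), n.choose i := by
  rw [Fintype.card_subtype,
    Finset.card_eq_sum_card_fiberwise (f := fun a => (zeroSet a).card) (t := Finset.range (r + 1))]
  · refine Finset.sum_congr rfl fun i hi => ?_
    have e := Finset.card_powersetCard i (Finset.univ : Finset (Fin n))
    rw [Finset.card_univ, Fintype.card_fin] at e
    rw [← e]
    refine Finset.card_nbij' zeroSet (fun s j => if j ∈ s then 0 else 1) ?_ ?_ ?_ ?_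
    · intro a ha
      simp only [Finset.coe_filter, Set.mem_ofPred_eq] at ha
      simp [Finset.mem_powersetCard, ha.2]
    · intro s hs
      have e : zeroSet (fun j => if j ∈ s then (0 : Fin 2) else 1) = s := by
        ext j; simp [mem_zeroSet]
      have hs' : s.card = i := by simpa using hs
      simp only [Finset.coe_filter, Finset.mem_filter, Finset.mem_univ, true_and,
        Set.mem_ofPred_eq, e, hs', and_true]
      exact Nat.lt_succ_iff.1 (Finset.mem_range.1 hi)
    · intro a _
      funext j
      have : ∀ x : Fin 2, (if x = 0 then (0 : Fin 2) else 1) = x := by decide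
      simp only [mem_zeroSet, this]
    · intro s _
      ext j; simp [mem_zeroSet]
  · intro a ha
    have := (Finset.mem_filter.1 ha).2
    simpa [Nat.lt_succ_iff] using this

theorem finrank_reedMuller (n r : ℕ) :
    Module.finrank (ZMod 2) (reedMuller n r) = ∑ i ∈ Finset.range (r + 1), n.choose i := by
  have hli : LinearIndependent (ZMod 2) fun a => hadamardPow n a :=
    Matrix.linearIndependent_rows_of_isUnit
      ⟨⟨hadamardPow n, hadamardPow n, hadamardPow_mul_self n, hadamardPow_mul_self n⟩, rfl⟩
  have h := finrank_span_eq_card (R := ZMod 2)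
    (hli.comp (Subtype.val : {a : Fin n → Fin 2 // (zeroSet a).card ≤ r} → _)
      Subtype.val_injective)
  rw [card_zeroSet_le, Set.range_comp, Subtype.range_coe_subtype] at h
  rw [reedMuller_eq_span, ← h]

/-! ### How slowly the rate falls when the order is fixed and the number of variables grows. -/

lemma sum_range_succ_choose_add (n r : ℕ) :
    ∑ i ∈ Finset.range (r + 1), (n + 1).choose i + n.choose r =
      2 * ∑ i ∈ Finset.range (r + 1), n.choose i := by
  induction r with
  | zero => simp
  | succ r ih =>
    rw [Finset.sum_range_succ, Finset.sum_range_succ (fun i => n.choose i), mul_add, ← ih,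
      Nat.choose_succ_succ]
    ring

lemma codeRate_reedMuller_sub_succ (n r : ℕ) :
    codeRate (reedMuller n r) - codeRate (reedMuller (n + 1) r) = n.choose r / 2 ^ (n + 1) := by
  have h := congrArg (Nat.cast (R := ℝ)) (sum_range_succ_choose_add n r)
  rw [codeRate, codeRate, finrank_reedMuller, finrank_reedMuller]
  simp only [Fintype.card_fun, Fintype.card_fin]
  push_cast at h ⊢
  rw [pow_succ]
  field_simp
  linarith

/-- A square-root saving over 4 ^ n, squared to stay in the natural numbers. The induction step
rests on (2n + 3)(2n + 1) ≤ 4(n + 1)². -/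
lemma centralBinom_sq_le (n : ℕ) : (2 * n + 1) * n.centralBinom ^ 2 ≤ (4 ^ n) ^ 2 := by
  induction n with
  | zero => simp
  | succ n ih =>
    have h := Nat.succ_mul_centralBinom_succ n
    have hp : 0 < (n + 1) ^ 2 := by positivity
    refine Nat.le_of_mul_le_mul_left (?_ : (n + 1) ^ 2 * _ ≤ (n + 1) ^ 2 * _) hp
    calc (n + 1) ^ 2 * ((2 * (n + 1) + 1) * (n + 1).centralBinom ^ 2)
        = (2 * (n + 1) + 1) * ((n + 1) * (n + 1).centralBinom) ^ 2 := by ring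
      _ = (4 * ((2 * n + 3) * (2 * n + 1))) * ((2 * n + 1) * n.centralBinom ^ 2) := by
          rw [h]; ring
      _ ≤ (4 * ((2 * n + 3) * (2 * n + 1))) * (4 ^ n) ^ 2 := Nat.mul_le_mul_left _ ih
      _ ≤ (16 * (n + 1) ^ 2) * (4 ^ n) ^ 2 := Nat.mul_le_mul_right _ (by nlinarith)
      _ = (n + 1) ^ 2 * (4 ^ (n + 1)) ^ 2 := by ring

/-- Even rows are bounded by their central coefficient; an odd row is first reduced to the even row
above it by Pascal's rule. -/
lemma choose_sq_le (n r : ℕ) : n * n.choose r ^ 2 ≤ (2 ^ n) ^ 2 := by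
  obtain ⟨l, rfl | rfl⟩ := Nat.even_or_odd' n
  · calc 2 * l * (2 * l).choose r ^ 2 ≤ (2 * l + 1) * l.centralBinom ^ 2 :=
        Nat.mul_le_mul (Nat.le_succ _) (Nat.pow_le_pow_left (Nat.choose_le_centralBinom r l) 2)
      _ ≤ _ := by
        rw [pow_mul]; exact centralBinom_sq_le l
  · have h : (2 * l + 1).choose r ≤ 2 * l.centralBinom := by
      cases r with
      | zero =>
        have := Nat.centralBinom_pos l
        simp; omega
      | succ r =>
        rw [Nat.choose_succ_succ]
        have := Nat.choose_le_centralBinom r l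
        have := Nat.choose_le_centralBinom (r + 1) l
        simp only [Nat.succ_eq_add_one]
        omega
    calc (2 * l + 1) * (2 * l + 1).choose r ^ 2
        ≤ (2 * l + 1) * (2 * l.centralBinom) ^ 2 :=
          Nat.mul_le_mul_left _ (Nat.pow_le_pow_left h 2)
      _ = 4 * ((2 * l + 1) * l.centralBinom ^ 2) := by ring
      _ ≤ 4 * (4 ^ l) ^ 2 := Nat.mul_le_mul_left _ (centralBinom_sq_le l)
      _ = _ := by rw [pow_succ 2, pow_mul]; norm_num; ring

lemma choose_div_two_pow_le (hn : 0 < n) (r : ℕ) :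
    (n.choose r : ℝ) / 2 ^ (n + 1) ≤ 1 / √n := by
  have h := choose_sq_le n r
  have h' : (n : ℝ) * (n.choose r : ℝ) ^ 2 ≤ (2 ^ n) ^ 2 := by exact_mod_cast h
  have hs : √(n : ℝ) * n.choose r ≤ 2 ^ n := by
    refine abs_le_of_sq_le_sq' ?_ (by positivity) |>.2
    rw [mul_pow, Real.sq_sqrt (Nat.cast_nonneg n)]
    exact h'
  have hpos : 0 < √(n : ℝ) := Real.sqrt_pos.2 (Nat.cast_pos.2 hn)
  rw [div_le_div_iff₀ (by positivity) hpos, pow_succ]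
  nlinarith [pow_pos (two_pos : (0 : ℝ) < 2) n]

/-- Lengthening a Reed–Muller code of given order by a bounded factor hardly lowers the rate. -/
lemma codeRate_reedMuller_sub_le (hn : 0 < n) (r k : ℕ) :
    codeRate (reedMuller n r) - codeRate (reedMuller (n + k) r) ≤ k * (1 / √n) := by
  induction k with
  | zero => simp
  | succ k ih =>
    have h1 := codeRate_reedMuller_sub_succ (n + k) r
    have h2 := choose_div_two_pow_le (n := n + k) (by omega) r
    have h3 : 1 / √((n + k : ℕ) : ℝ) ≤ 1 / √n :=
      one_div_le_one_div_of_le (Real.sqrt_pos.2 (Nat.cast_pos.2 hn))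
        (Real.sqrt_le_sqrt (Nat.cast_le.2 (Nat.le_add_right n k)))
    have h4 : n + (k + 1) = n + k + 1 := by ring
    rw [h4]
    push_cast at h1 h2 h3 ih ⊢
    linarith

end ReedMuller

/-! ### Two overlapping restrictions of a code, and invariance under symmetries. -/

section TwoLooks

/-- The pattern with given restrictions to a set of positions and to its complement. -/
def gluePattern {ι : Type*} (P : ι → Prop) [DecidablePred P] (s : {x // P x} → Bool)
    (t : {x // ¬ P x} → Bool) : ι → Bool :=
  Sum.elim s t ∘ (Equiv.sumCompl P).symm

section

variable {ι : Type*} (P : ι → Prop) [DecidablePred P]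

lemma gluePattern_of_pos (s : {x // P x} → Bool) (t : {x // ¬ P x} → Bool) {x : ι} (h : P x) :
    gluePattern P s t x = s ⟨x, h⟩ := by
  simp [gluePattern, Equiv.sumCompl_symm_apply_of_pos h]

lemma gluePattern_of_neg (s : {x // P x} → Bool) (t : {x // ¬ P x} → Bool) {x : ι} (h : ¬ P x) :
    gluePattern P s t x = t ⟨x, h⟩ := by
  simp [gluePattern, Equiv.sumCompl_symm_apply_of_neg h]

lemma gluePattern_update [DecidableEq ι] (s : {x // P x} → Bool) (t : {x // ¬ P x} → Bool)
    (j : {x // P x}) (b : Bool) : gluePattern P (Function.update s j b) t =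
      Function.update (gluePattern P s t) j b := by
  funext x
  by_cases h : P x
  · by_cases e : x = j
    · subst e; simp [gluePattern_of_pos P _ _ h]
    · have : (⟨x, h⟩ : {x // P x}) ≠ j := fun h' => e (congrArg Subtype.val h')
      simp [gluePattern_of_pos P _ _ h, Function.update_of_ne, e, this]
  · have e : x ≠ j := fun h' => h (h' ▸ j.2)
    simp [gluePattern_of_neg P _ _ h, Function.update_of_ne, e]

end

variable {ι κ : Type*} [Fintype ι] [DecidableEq ι] [Fintype κ] [DecidableEq κ] {p : ℝ}

section

variable (P : ι → Prop) [DecidablePred P]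

lemma bernoulliMean_gluePattern (F : (ι → Bool) → ℝ) :
    bernoulliMean p (fun s : {x // P x} → Bool =>
      bernoulliMean p fun t : {x // ¬ P x} → Bool => F (gluePattern P s t)) =
      bernoulliMean p F := by
  rw [← bernoulliMean_equiv (Equiv.sumCompl P).symm, bernoulliMean_sum]
  rfl

/-- The variance of a conditional expectation is bounded by the influences of the conditioning
coordinates, for monotone functions of range at most one. -/
lemma bernoulliMean_condMean_sq_le (h0 : 0 ≤ p) (h1 : p ≤ 1) {F : (ι → Bool) → ℝ}
    (hF0 : ∀ j ω, 0 ≤ discreteDeriv j F ω) (hF1 : ∀ j ω, discreteDeriv j F ω ≤ 1) :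
    bernoulliMean p (fun s : {x // P x} → Bool =>
      (bernoulliMean p fun t : {x // ¬ P x} → Bool => F (gluePattern P s t)) ^ 2) ≤
    bernoulliMean p F ^ 2 + ∑ j : {x // P x}, bernoulliMean p (discreteDeriv (j : ι) F) := by
  set G : ({x // P x} → Bool) → ℝ := fun s =>
    bernoulliMean p fun t : {x // ¬ P x} → Bool => F (gluePattern P s t) with hG
  have hD : ∀ j s, discreteDeriv j G s =
      bernoulliMean p fun t => discreteDeriv (j : ι) F (gluePattern P s t) := by
    intro j s
    simp only [discreteDeriv, hG, ← bernoulliMean_sub, gluePattern_update]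
  -- The derivatives of G are means of derivatives of F, hence lie in [0,1] and dominate their
  -- squares.
  have hle : ∀ j, bernoulliMean p (fun s => discreteDeriv j G s ^ 2) ≤
      bernoulliMean p (discreteDeriv (j : ι) F) := by
    intro j
    rw [← bernoulliMean_gluePattern P (discreteDeriv (j : ι) F)]
    refine bernoulliMean_mono h0 h1 fun s => ?_
    rw [hD]
    have a0 := bernoulliMean_nonneg h0 h1 fun t => hF0 j (gluePattern P s t)
    have a1 := bernoulliMean_le_one h0 h1 fun t => hF1 j (gluePattern P s t)
    nlinarith
  have hES := bernoulliMean_sq_le h0 h1 G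
  have hmean : bernoulliMean p G = bernoulliMean p F := bernoulliMean_gluePattern P F
  rw [hmean] at hES
  have hsum := Finset.sum_le_sum fun j (_ : j ∈ Finset.univ) => hle j
  have hsum0 : 0 ≤ ∑ j, bernoulliMean p (fun s => discreteDeriv j G s ^ 2) :=
    Finset.sum_nonneg fun j _ => bernoulliMean_nonneg h0 h1 fun s => sq_nonneg _
  have hp : p * (1 - p) ≤ 1 := by nlinarith
  nlinarith [mul_le_mul_of_nonneg_right hp hsum0]

/-- Two restrictions of a code that overlap in the positions `P` are conditionally independent
looks at the same bit. -/
lemma bernoulliMean_unrecoverableIndicator_le_sq {C : Submodule (ZMod 2) (ι → ZMod 2)}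
    {D : Submodule (ZMod 2) (κ → ZMod 2)} {φ ψ : ι → κ} (hφ : Function.Injective φ)
    (hψ : Function.Injective ψ) (hφψ : ∀ x, P x → φ x = ψ x)
    (hP : ∀ x y, φ x = ψ y → P x ∧ P y) (hDφ : ∀ c ∈ D, c ∘ φ ∈ C) (hDψ : ∀ c ∈ D, c ∘ ψ ∈ C)
    {i : ι} (hi : P i) (h0 : 0 ≤ p) (h1 : p ≤ 1) :
    bernoulliMean p (unrecoverableIndicator D (φ i)) ≤
      bernoulliMean p (fun s : {x // P x} → Bool =>
        (bernoulliMean p fun t : {x // ¬ P x} → Bool =>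
          unrecoverableIndicator C i (gluePattern P s t)) ^ 2) := by
  -- Three disjoint blocks of positions of D: the overlap, the rest of the first look and the rest
  -- of the second.
  let θ : {x // P x} ⊕ ({x // ¬ P x} ⊕ {x // ¬ P x}) → κ :=
    Sum.elim (fun x => φ x) (Sum.elim (fun x => φ x) (fun x => ψ x))
  have hθ : Function.Injective θ := by
    refine Function.Injective.sumElim (hφ.comp Subtype.val_injective)
      (Function.Injective.sumElim (hφ.comp Subtype.val_injective)
        (hψ.comp Subtype.val_injective) fun x y h => x.2 (hP _ _ h).1) ?_
    rintro x (y | y) h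
    · exact y.2 (hφ h ▸ x.2)
    · exact y.2 (hP _ _ h).2
  let f := unrecoverableIndicator C i
  have hA : ∀ ω : κ → Bool, ω ∘ φ =
      gluePattern P (ω ∘ θ ∘ Sum.inl) (ω ∘ θ ∘ Sum.inr ∘ Sum.inl) := by
    intro ω
    funext x
    by_cases h : P x
    · rw [gluePattern_of_pos P _ _ h]; rfl
    · rw [gluePattern_of_neg P _ _ h]; rfl
  have hB : ∀ ω : κ → Bool, ω ∘ ψ =
      gluePattern P (ω ∘ θ ∘ Sum.inl) (ω ∘ θ ∘ Sum.inr ∘ Sum.inr) := by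
    intro ω
    funext x
    by_cases h : P x
    · rw [gluePattern_of_pos P _ _ h]
      exact congrArg ω (hφψ x h).symm
    · rw [gluePattern_of_neg P _ _ h]; rfl
  have hpt : ∀ ω, unrecoverableIndicator D (φ i) ω ≤ f (ω ∘ φ) * f (ω ∘ ψ) := by
    intro ω
    have ha := unrecoverableIndicator_le_comp hφ hDφ i ω
    have hb := unrecoverableIndicator_le_comp hψ hDψ i ω
    rw [← hφψ i hi] at hb
    have h0 := unrecoverableIndicator_nonneg D (φ i) ω
    have h1 := unrecoverableIndicator_nonneg C i (ω ∘ φ)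
    by_cases h : IsUnrecoverable D (φ i) ω
    · rw [unrecoverableIndicator, if_pos h] at ha hb ⊢
      nlinarith [mul_le_mul ha hb zero_le_one h1]
    · rw [unrecoverableIndicator, if_neg h]
      exact mul_nonneg h1 (unrecoverableIndicator_nonneg C i (ω ∘ ψ))
  let H : ({x // P x} ⊕ ({x // ¬ P x} ⊕ {x // ¬ P x}) → Bool) → ℝ := fun ω =>
    f (gluePattern P (ω ∘ Sum.inl) (ω ∘ Sum.inr ∘ Sum.inl)) *
      f (gluePattern P (ω ∘ Sum.inl) (ω ∘ Sum.inr ∘ Sum.inr))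
  calc bernoulliMean p (unrecoverableIndicator D (φ i))
      ≤ bernoulliMean p (fun ω : κ → Bool => H (ω ∘ θ)) := by
        refine bernoulliMean_mono h0 h1 fun ω => (hpt ω).trans_eq ?_
        rw [hA, hB]; rfl
    _ = bernoulliMean p H := bernoulliMean_comp_injective hθ H
    _ = _ := by
        rw [bernoulliMean_sum]
        congr 1
        funext s
        -- With the overlap pattern s fixed, the two factors depend on separate blocks and have the
        -- same mean, whence the square.
        rw [bernoulliMean_sum, sq, ← bernoulliMean_mul_const]
        congr 1
        funext t
        rw [← bernoulliMean_const_mul]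
        rfl

end

variable {C : Submodule (ZMod 2) (ι → ZMod 2)} {σ : ι ≃ ι}

lemma bernoulliMean_unrecoverableIndicator_symmetry (h1 : ∀ c ∈ C, c ∘ σ ∈ C)
    (h2 : ∀ c ∈ C, c ∘ σ.symm ∈ C) (i : ι) :
    bernoulliMean p (unrecoverableIndicator C (σ i)) =
      bernoulliMean p (unrecoverableIndicator C i) := by
  rw [← bernoulliMean_equiv σ (unrecoverableIndicator C i)]
  congr 1
  funext ω
  exact (unrecoverableIndicator_comp_equiv C i h1 h2 ω).symm

/-- A symmetry that fixes i preserves the function, so it only permutes the influences. -/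
lemma bernoulliMean_discreteDeriv_symmetry (h1 : ∀ c ∈ C, c ∘ σ ∈ C)
    (h2 : ∀ c ∈ C, c ∘ σ.symm ∈ C) {i : ι} (hi : σ i = i) (j : ι) :
    bernoulliMean p (discreteDeriv (σ j) (unrecoverableIndicator C i)) =
      bernoulliMean p (discreteDeriv j (unrecoverableIndicator C i)) := by
  have h : (fun ω : ι → Bool => unrecoverableIndicator C i (ω ∘ σ)) =
      unrecoverableIndicator C i := by
    funext ω
    rw [unrecoverableIndicator_comp_equiv C i h1 h2, hi]
  rw [← bernoulliMean_equiv σ (discreteDeriv j (unrecoverableIndicator C i))]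
  congr 1
  funext ω
  rw [← σ.symm_apply_apply j, ← discreteDeriv_equiv σ, h]
  simp

end TwoLooks

/-! ### Double transitivity of the affine group and its effect on failure probabilities and
influences. -/

section Symmetry

variable {n r : ℕ}

lemma exists_translation (r : ℕ) (i : Fin n → Fin 2) : ∃ σ : (Fin n → Fin 2) ≃ (Fin n → Fin 2),
    σ 0 = i ∧ (∀ c ∈ reedMuller n r, c ∘ σ ∈ reedMuller n r) ∧
      ∀ c ∈ reedMuller n r, c ∘ σ.symm ∈ reedMuller n r := by
  let σ : (Fin n → ZMod 2) ≃ (Fin n → ZMod 2) := Equiv.addRight i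
  refine ⟨σ, zero_add (M := Fin n → ZMod 2) i, fun c hc => ?_, fun c hc => ?_⟩
  · exact comp_affine_mem_reedMuller LinearMap.id i hc
  · exact comp_affine_mem_reedMuller LinearMap.id (-i : Fin n → ZMod 2) hc

lemma exists_linear_symmetry (r : ℕ) {i j : Fin n → Fin 2} (hi : i ≠ 0) (hj : j ≠ 0) :
    ∃ σ : (Fin n → Fin 2) ≃ (Fin n → Fin 2),
    σ 0 = 0 ∧ σ i = j ∧ (∀ c ∈ reedMuller n r, c ∘ σ ∈ reedMuller n r) ∧
      ∀ c ∈ reedMuller n r, c ∘ σ.symm ∈ reedMuller n r := by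
  have hlin : ∀ (A : (Fin n → ZMod 2) →ₗ[ZMod 2] (Fin n → ZMod 2)), ∀ c ∈ reedMuller n r,
      (fun x : Fin n → ZMod 2 => c (A x)) ∈ reedMuller n r := by
    intro A c hc
    simpa only [add_zero] using comp_affine_mem_reedMuller A 0 hc
  obtain ⟨e, he⟩ := exists_linearEquiv_apply_eq (x := i) (y := j) hi hj
  exact ⟨e.toEquiv, e.map_zero, he, hlin e.toLinearMap, hlin e.symm.toLinearMap⟩

/-- The probability that a bit of the Reed–Muller code cannot be recovered from the other bits
that are not erased. -/
noncomputable def extrinsicFailure (n r : ℕ) (p : ℝ) : ℝ :=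
  bernoulliMean p (unrecoverableIndicator (reedMuller n r) 0)

lemma bernoulliMean_unrecoverableIndicator_reedMuller (p : ℝ) (i : Fin n → Fin 2) :
    bernoulliMean p (unrecoverableIndicator (reedMuller n r) i) = extrinsicFailure n r p := by
  obtain ⟨σ, rfl, h1, h2⟩ := exists_translation r i
  exact bernoulliMean_unrecoverableIndicator_symmetry h1 h2 0

lemma integral_extrinsicFailure (n r : ℕ) :
    ∫ p in (0 : ℝ)..1, extrinsicFailure n r p = codeRate (reedMuller n r) := by
  have h := sum_integral_unrecoverableIndicator (reedMuller n r)
  simp only [bernoulliMean_unrecoverableIndicator_reedMuller, Finset.sum_const, nsmul_eq_mul,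
    Finset.card_univ] at h
  rw [codeRate, ← h, mul_div_cancel_left₀]
  exact Nat.cast_ne_zero.2 Fintype.card_ne_zero

/-- The influence of position `j` on the recoverability of the bit at the origin. -/
noncomputable def influence (n r : ℕ) (p : ℝ) (j : Fin n → Fin 2) : ℝ :=
  bernoulliMean p (discreteDeriv j (unrecoverableIndicator (reedMuller n r) 0))

lemma hasDerivAt_extrinsicFailure (n r : ℕ) (p : ℝ) :
    HasDerivAt (extrinsicFailure n r) (∑ j, influence n r p j) p :=
  hasDerivAt_bernoulliMean _ p

lemma influence_nonneg {p : ℝ} (h0 : 0 ≤ p) (h1 : p ≤ 1) (j : Fin n → Fin 2) :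
    0 ≤ influence n r p j :=
  bernoulliMean_nonneg h0 h1 fun ω => discreteDeriv_unrecoverableIndicator_nonneg _ _ _ ω

lemma influence_zero (n r : ℕ) (p : ℝ) : influence n r p 0 = 0 := by
  have : discreteDeriv 0 (unrecoverableIndicator (reedMuller n r) 0) = fun _ => 0 :=
    funext fun ω => discreteDeriv_unrecoverableIndicator_self _ _ ω
  rw [influence, this, bernoulliMean_const]

lemma influence_eq (r : ℕ) (p : ℝ) {i j : Fin n → Fin 2} (hi : i ≠ 0) (hj : j ≠ 0) :
    influence n r p j = influence n r p i := by
  obtain ⟨σ, h0, rfl, h1, h2⟩ := exists_linear_symmetry r hi hj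
  exact bernoulliMean_discreteDeriv_symmetry h1 h2 h0 i

/-- A set of positions that contains the origin carries at most its share of the influences. -/
lemma mul_sum_influence_le {p : ℝ} (h0 : 0 ≤ p) (h1 : p ≤ 1) {A : Finset (Fin n → Fin 2)}
    (hA : 0 ∈ A) {K : ℕ} (hK : 1 ≤ K) (hcard : A.card * K ≤ Fintype.card (Fin n → Fin 2)) :
    K * ∑ j ∈ A, influence n r p j ≤ ∑ j, influence n r p j := by
  obtain ⟨I, hI0, hI⟩ : ∃ I : ℝ, 0 ≤ I ∧ ∀ j : Fin n → Fin 2, j ≠ 0 → influence n r p j = I := by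
    by_cases h : ∃ i : Fin n → Fin 2, i ≠ 0
    · obtain ⟨i, hi⟩ := h
      exact ⟨_, influence_nonneg h0 h1 i, fun j hj => influence_eq r p hi hj⟩
    · push Not at h
      exact ⟨0, le_rfl, fun j hj => absurd (h j) hj⟩
  -- All nonzero positions share one influence I, and the origin contributes nothing.
  have hsum : ∀ B : Finset (Fin n → Fin 2), 0 ∈ B →
      ∑ j ∈ B, influence n r p j = (B.card - 1 : ℝ) * I := by
    intro B hB
    rw [← Finset.add_sum_erase _ _ hB, influence_zero, zero_add,
      Finset.sum_congr rfl fun j hj => hI j (Finset.ne_of_mem_erase hj), Finset.sum_const,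
      nsmul_eq_mul, Finset.cast_card_erase_of_mem hB]
  rw [hsum A hA, hsum _ (Finset.mem_univ _), ← mul_assoc]
  refine mul_le_mul_of_nonneg_right ?_ hI0
  have hcard' : (A.card * K : ℝ) ≤ (Finset.univ : Finset (Fin n → Fin 2)).card := by
    exact_mod_cast hcard
  have hK' : (1 : ℝ) ≤ K := by exact_mod_cast hK
  -- (|A| - 1)K ≤ 2^n - K ≤ 2^n - 1, where the last step uses K ≥ 1.
  nlinarith

end Symmetry

/-! ### The recursion between lengths n and n + k, and the resulting sharp threshold. -/

section Capacity

variable {n k r : ℕ}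

/-- The embedding of the `n`-dimensional space into the `(n + k)`-dimensional space that uses
the first `n` coordinates. -/
def firstLook (n k : ℕ) : (Fin n → ZMod 2) →ₗ[ZMod 2] (Fin (n + k) → ZMod 2) :=
  LinearMap.pi fun i => if h : i.1 < n then LinearMap.proj ⟨i, h⟩ else 0

/-- The embedding of the `n`-dimensional space into the `(n + k)`-dimensional space that uses
the first `n - k` and the last `k` coordinates. -/
def secondLook (n k : ℕ) : (Fin n → ZMod 2) →ₗ[ZMod 2] (Fin (n + k) → ZMod 2) :=
  LinearMap.pi fun i => if h : i.1 < n then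
    if i.1 < n - k then LinearMap.proj ⟨i, h⟩ else 0
    -- Target coordinates n, …, n + k - 1 read source coordinates n - k, …, n - 1; for k ≤ n the
    -- default 0 is not reached.
    else if h' : i.1 - k < n then LinearMap.proj ⟨i - k, h'⟩ else 0

/-- The positions in the intersection of the two embeddings. -/
def InBothLooks (n k : ℕ) (x : Fin n → Fin 2) : Prop := ∀ i : Fin n, n - k ≤ i.1 → x i = 0

lemma firstLook_apply_castAdd (x : Fin n → ZMod 2) (i : Fin n) :
    firstLook n k x (Fin.castAdd k i) = x i := by
  simp [firstLook]

lemma firstLook_apply_of_le (x : Fin n → ZMod 2) (i : Fin (n + k)) (hi : n ≤ i.1) :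
    firstLook n k x i = 0 := by
  simp [firstLook, not_lt.2 hi]

lemma secondLook_apply_of_lt (x : Fin n → ZMod 2) (i : Fin n) (hi : i.1 < n - k) :
    secondLook n k x (Fin.castAdd k i) = x i := by
  simp [secondLook, hi]

lemma secondLook_apply_of_le (x : Fin n → ZMod 2) (i : Fin n) (hi : n - k ≤ i.1) :
    secondLook n k x (Fin.castAdd k i) = 0 := by
  simp [secondLook, not_lt.2 hi]

lemma secondLook_apply_addNat (hk : k ≤ n) (x : Fin n → ZMod 2) (i : Fin n) (hi : n - k ≤ i.1) :
    secondLook n k x (i.addNat k) = x i := by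
  have h1 : ¬ i.1 + k < n := by omega
  simp [secondLook, h1]

lemma firstLook_injective (n k : ℕ) : Function.Injective (firstLook n k) := fun x y h =>
  funext fun i => by rw [← firstLook_apply_castAdd (k := k) x, h, firstLook_apply_castAdd]

lemma secondLook_injective (hk : k ≤ n) : Function.Injective (secondLook n k) := fun x y h =>
  funext fun i => by
    rcases lt_or_ge i.1 (n - k) with hi | hi
    · rw [← secondLook_apply_of_lt x i hi, h, secondLook_apply_of_lt y i hi]
    · rw [← secondLook_apply_addNat hk x i hi, h, secondLook_apply_addNat hk y i hi]

lemma firstLook_eq_secondLook (hk : k ≤ n) {x : Fin n → ZMod 2} (hx : InBothLooks n k x) :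
    firstLook n k x = secondLook n k x := by
  funext i
  rcases lt_or_ge i.1 n with h | h
  · obtain ⟨j, rfl⟩ : ∃ j : Fin n, Fin.castAdd k j = i := ⟨⟨i, h⟩, rfl⟩
    rw [firstLook_apply_castAdd]
    rcases lt_or_ge j.1 (n - k) with hj | hj
    · rw [secondLook_apply_of_lt x j hj]
    · rw [secondLook_apply_of_le x j hj]; exact hx j hj
  · obtain ⟨j, rfl, hj⟩ : ∃ j : Fin n, j.addNat k = i ∧ n - k ≤ j.1 := by
      refine ⟨⟨i - k, by omega⟩, Fin.ext ?_, ?_⟩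
      · simp; omega
      · simp; omega
    rw [firstLook_apply_of_le x _ h, secondLook_apply_addNat hk x j hj]
    exact (hx j hj).symm

/-- The first look vanishes on the target coordinates from n on, the second on those from n - k to n
- 1; comparing both ranges kills the last k coordinates of x and of y. -/
lemma inBothLooks_of_eq (hk : k ≤ n) {x y : Fin n → ZMod 2}
    (h : firstLook n k x = secondLook n k y) : InBothLooks n k x ∧ InBothLooks n k y := by
  refine ⟨fun i hi => ?_, fun i hi => ?_⟩
  · have := congrFun h (Fin.castAdd k i)
    rwa [firstLook_apply_castAdd, secondLook_apply_of_le y i hi] at this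
  · have := congrFun h (i.addNat k)
    rw [firstLook_apply_of_le x _ (by simp; omega), secondLook_apply_addNat hk y i hi] at this
    exact this.symm

instance (n k : ℕ) : DecidablePred (InBothLooks n k) := fun _ => Fintype.decidableForallFintype

/-- The last k coordinates, zero in the overlap, can be filled in freely. -/
lemma card_inBothLooks_mul_le (hk : k ≤ n) :
    (Finset.univ.filter (InBothLooks n k)).card * 2 ^ k ≤ Fintype.card (Fin n → Fin 2) := by
  let g : {x // InBothLooks n k x} × (Fin k → Fin 2) → (Fin n → Fin 2) := fun q i =>
    if h : n - k ≤ i.1 then q.2 ⟨i - (n - k), by omega⟩ else q.1.1 i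
  have hg : Function.Injective g := by
    rintro ⟨⟨x, hx⟩, s⟩ ⟨⟨y, hy⟩, t⟩ h
    have e1 : x = y := by
      funext i
      by_cases hi : n - k ≤ i.1
      · rw [hx i hi, hy i hi]
      · have e := congrFun h i
        simp only [g] at e
        rwa [dif_neg hi, dif_neg hi] at e
    have e2 : s = t := by
      funext i
      have e := congrFun h ⟨n - k + i, by omega⟩
      simp only [g] at e
      rw [dif_pos (Nat.le_add_right _ _), dif_pos (Nat.le_add_right _ _)] at e
      simpa only [Nat.add_sub_cancel_left, Fin.eta] using e
    subst e1 e2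
    rfl
  have := Fintype.card_le_of_injective g hg
  rwa [Fintype.card_prod, Fintype.card_subtype, Fintype.card_fun, Fintype.card_fin,
    Fintype.card_fin] at this

/-- The two looks give the mean of a squared conditional expectation. Efron–Stein replaces it by the
squared mean plus the influences of the overlap, which hold at most a 2^(-k) share of the total. -/
lemma extrinsicFailure_add_le (hk : k ≤ n) (r : ℕ) {p : ℝ} (h0 : 0 ≤ p) (h1 : p ≤ 1) :
    extrinsicFailure (n + k) r p ≤
      extrinsicFailure n r p ^ 2 + (1 / 2 ^ k) * ∑ j, influence n r p j := by
  have hlin : ∀ (A : (Fin n → ZMod 2) →ₗ[ZMod 2] (Fin (n + k) → ZMod 2)),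
      ∀ c ∈ reedMuller (n + k) r, (fun x : Fin n → ZMod 2 => c (A x)) ∈ reedMuller n r := by
    intro A c hc
    simpa only [add_zero] using comp_affine_mem_reedMuller A 0 hc
  have hz : InBothLooks n k 0 := fun _ _ => rfl
  let φ : (Fin n → Fin 2) → (Fin (n + k) → Fin 2) := firstLook n k
  let ψ : (Fin n → Fin 2) → (Fin (n + k) → Fin 2) := secondLook n k
  have h2 := bernoulliMean_unrecoverableIndicator_le_sq (InBothLooks n k) (φ := φ) (ψ := ψ)
    (C := reedMuller n r) (D := reedMuller (n + k) r)
    (firstLook_injective n k) (secondLook_injective hk) (fun x hx => firstLook_eq_secondLook hk hx)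
    (fun x y h => inBothLooks_of_eq hk h) (hlin _) (hlin _) hz h0 h1
  rw [bernoulliMean_unrecoverableIndicator_reedMuller] at h2
  have h3 := bernoulliMean_condMean_sq_le (InBothLooks n k) h0 h1
    (fun j ω => discreteDeriv_unrecoverableIndicator_nonneg (reedMuller n r) 0 j ω)
    (fun j ω => discreteDeriv_unrecoverableIndicator_le_one (reedMuller n r) 0 j ω)
  have h4 := mul_sum_influence_le (r := r) h0 h1 (A := Finset.univ.filter (InBothLooks n k))
    (by simpa using hz) (Nat.one_le_two_pow (n := k)) (card_inBothLooks_mul_le hk)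
  have h5 : ∑ j : {x // InBothLooks n k x}, influence n r p j =
      ∑ j ∈ Finset.univ.filter (InBothLooks n k), influence n r p j :=
    (Finset.sum_subtype _ (by simp) _).symm
  have h6 : ∑ j : {x // InBothLooks n k x}, influence n r p j ≤
      (1 / 2 ^ k) * ∑ j, influence n r p j := by
    rw [h5, one_div_mul_eq_div, le_div_iff₀ (by positivity), mul_comm]
    exact_mod_cast h4
  exact (h2.trans h3).trans (add_le_add_right h6 _)

lemma continuous_extrinsicFailure (n r : ℕ) : Continuous (extrinsicFailure n r) :=
  continuous_bernoulliMean _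

lemma extrinsicFailure_nonneg (n r : ℕ) {p : ℝ} (h0 : 0 ≤ p) (h1 : p ≤ 1) :
    0 ≤ extrinsicFailure n r p :=
  bernoulliMean_nonneg h0 h1 fun _ => unrecoverableIndicator_nonneg _ _ _

lemma extrinsicFailure_le_one (n r : ℕ) {p : ℝ} (h0 : 0 ≤ p) (h1 : p ≤ 1) :
    extrinsicFailure n r p ≤ 1 :=
  bernoulliMean_le_one h0 h1 fun _ => unrecoverableIndicator_le_one _ _ _

lemma monotoneOn_extrinsicFailure (n r : ℕ) :
    MonotoneOn (extrinsicFailure n r) (Set.Icc 0 1) := by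
  refine monotoneOn_of_hasDerivWithinAt_nonneg (convex_Icc 0 1)
    (continuous_extrinsicFailure n r).continuousOn
    (fun p _ => (hasDerivAt_extrinsicFailure n r p).hasDerivWithinAt) fun p hp => ?_
  rw [interior_Icc] at hp
  exact Finset.sum_nonneg fun j _ => influence_nonneg hp.1.le hp.2.le j

/-- On average over the erasure probability, recoverability is nearly deterministic. -/
lemma integral_extrinsicFailure_mul_le (hk : k ≤ n) (r : ℕ) :
    ∫ p in (0 : ℝ)..1, extrinsicFailure n r p * (1 - extrinsicFailure n r p) ≤
      codeRate (reedMuller n r) - codeRate (reedMuller (n + k) r) + 1 / 2 ^ k := by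
  have c1 := continuous_extrinsicFailure n r
  have c2 := continuous_extrinsicFailure (n + k) r
  have c3 : Continuous fun p => ∑ j, influence n r p j :=
    continuous_finsetSum _ fun j _ => continuous_bernoulliMean _
  -- The total influence is the derivative of a function with values in [0,1].
  have hd : ∫ p in (0 : ℝ)..1, ∑ j, influence n r p j ≤ 1 := by
    rw [intervalIntegral.integral_eq_sub_of_hasDerivAt
      (fun p _ => hasDerivAt_extrinsicFailure n r p) (c3.intervalIntegrable _ _)]
    linarith [extrinsicFailure_le_one n r zero_le_one le_rfl,
      extrinsicFailure_nonneg n r le_rfl zero_le_one]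
  calc ∫ p in (0 : ℝ)..1, extrinsicFailure n r p * (1 - extrinsicFailure n r p)
      ≤ ∫ p in (0 : ℝ)..1, ((extrinsicFailure n r p - extrinsicFailure (n + k) r p) +
          (1 / 2 ^ k) * ∑ j, influence n r p j) := by
        refine intervalIntegral.integral_mono_on zero_le_one
          ((c1.mul (continuous_const.sub c1)).intervalIntegrable _ _)
          (((c1.sub c2).add (continuous_const.mul c3)).intervalIntegrable _ _) fun p hp => ?_
        linarith [extrinsicFailure_add_le hk r hp.1 hp.2]
    _ = codeRate (reedMuller n r) - codeRate (reedMuller (n + k) r) +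
          (1 / 2 ^ k) * ∫ p in (0 : ℝ)..1, ∑ j, influence n r p j := by
        have e := intervalIntegral.integral_add (μ := MeasureTheory.volume)
          ((c1.sub c2).intervalIntegrable 0 1)
          ((c3.const_mul (1 / 2 ^ k)).intervalIntegrable 0 1)
        refine e.trans ?_
        simp only [Pi.sub_apply]
        rw [intervalIntegral.integral_sub (c1.intervalIntegrable _ _) (c2.intervalIntegrable _ _),
          intervalIntegral.integral_const_mul, integral_extrinsicFailure,
          integral_extrinsicFailure]
    _ ≤ _ := by
        have : (1 / 2 ^ k : ℝ) * ∫ p in (0 : ℝ)..1, ∑ j, influence n r p j ≤ 1 / 2 ^ k * 1 :=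
          mul_le_mul_of_nonneg_left hd (by positivity)
        linarith

/-- Below the average of a monotone function with small `∫ h (1 - h)`, its values are small. -/
lemma lt_of_integral_mul_lt {h : ℝ → ℝ} (hc : Continuous h) (hmono : MonotoneOn h (Set.Icc 0 1))
    (h0 : ∀ p ∈ Set.Icc (0 : ℝ) 1, 0 ≤ h p) (h1 : ∀ p ∈ Set.Icc (0 : ℝ) 1, h p ≤ 1)
    {ε δ : ℝ} (hε0 : 0 ≤ ε) (hε1 : ε ≤ 1) (hδ0 : 0 ≤ δ)
    (hlt : ∫ p in (0 : ℝ)..1, h p * (1 - h p) < δ * (1 - ε - ∫ p in (0 : ℝ)..1, h p)) :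
    h ε < δ := by
  by_contra hδ
  push Not at hδ
  have ci : ∀ {f : ℝ → ℝ}, Continuous f → ∀ a b, IntervalIntegrable f MeasureTheory.volume a b :=
    fun hf a b => hf.intervalIntegrable a b
  have c2 : Continuous fun p => h p * (1 - h p) := hc.mul (continuous_const.sub hc)
  -- If h ε ≥ δ, then h ≥ δ on all of [ε,1] by monotonicity; dropping the part over [0,ε] then
  -- contradicts the hypothesis.
  have a1 : ∫ p in ε..1, δ * (1 - h p) ≤ ∫ p in ε..1, h p * (1 - h p) := by
    refine intervalIntegral.integral_mono_on hε1
      (ci (continuous_const.mul (continuous_const.sub hc)) _ _) (ci c2 _ _) fun p hp => ?_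
    have hp' : p ∈ Set.Icc (0 : ℝ) 1 := ⟨hε0.trans hp.1, hp.2⟩
    exact mul_le_mul_of_nonneg_right (hδ.trans (hmono ⟨hε0, hε1⟩ hp' hp.1))
      (by linarith [h1 p hp'])
  have a2 : ∫ p in ε..1, δ * (1 - h p) = δ * ((1 - ε) - ∫ p in ε..1, h p) := by
    rw [intervalIntegral.integral_const_mul, intervalIntegral.integral_sub
      (ci continuous_const _ _) (ci hc _ _), intervalIntegral.integral_const]
    simp
  have a3 := intervalIntegral.integral_add_adjacent_intervals (ci c2 0 ε) (ci c2 ε 1)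
  have a4 := intervalIntegral.integral_add_adjacent_intervals (ci hc 0 ε) (ci hc ε 1)
  have a5 : 0 ≤ ∫ p in (0 : ℝ)..ε, h p * (1 - h p) := by
    refine intervalIntegral.integral_nonneg hε0 fun p hp => ?_
    have hp' : p ∈ Set.Icc (0 : ℝ) 1 := ⟨hp.1, hp.2.trans hε1⟩
    exact mul_nonneg (h0 p hp') (by linarith [h1 p hp'])
  have a6 : 0 ≤ ∫ p in (0 : ℝ)..ε, h p :=
    intervalIntegral.integral_nonneg hε0 fun p hp => h0 p ⟨hp.1, hp.2.trans hε1⟩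
  have a7 := mul_nonneg hδ0 a6
  rw [a2] at a1
  have a8 : δ * ((1 - ε) - ∫ p in ε..1, h p) =
      δ * (1 - ε - ∫ p in (0 : ℝ)..1, h p) + δ * ∫ p in (0 : ℝ)..ε, h p := by
    rw [← a4]; ring
  linarith

end Capacity

theorem theorem1 (m r : ℕ → ℕ) (hm : StrictMono m) (R : ℝ) (hR0 : 0 < R) (hR1 : R < 1)
    (hrate : Tendsto (fun k => codeRate (reedMuller (m k) (r k))) atTop (𝓝 R))
    (ε : ℝ) (hε0 : 0 ≤ ε) (hε1 : ε < 1 - R) (δ : ℝ) (hδ : 0 < δ) :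
    ∃ n₀ : ℕ, ∀ k : ℕ, n₀ < m k → ∀ i : Fin (m k) → Fin 2,
      bitMAPErrorProb (reedMuller (m k) (r k)) ε i fullObs ≤ δ ∧
      bitMAPErrorProb (reedMuller (m k) (r k)) ε i (extrinsicObs i) ≤ δ := by
  have hε : ε ≤ 1 := by linarith
  -- Half of the gap: once the rate is below R + γ, the quantity 1 - ε - rate still exceeds γ.
  set γ := (1 - R - ε) / 2 with hγ
  have hγ0 : 0 < γ := by rw [hγ]; linarith
  have hpos : 0 < δ * γ / 2 := by positivity
  -- The number l of extra variables is fixed first, so that 2^(-l) uses half of the budget δγ; the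
  -- rate loss l/√(m k) gets the other half as k grows.
  obtain ⟨l, hl⟩ := exists_pow_lt_of_lt_one hpos (by norm_num : (1 / 2 : ℝ) < 1)
  have hsqrt : Tendsto (fun k => (l : ℝ) * (1 / √(m k : ℝ))) atTop (𝓝 0) := by
    have h1 : Tendsto (fun k => √(m k : ℝ)) atTop atTop :=
      Real.tendsto_sqrt_atTop.comp (tendsto_natCast_atTop_atTop.comp hm.tendsto_atTop)
    simpa using (tendsto_const_nhds (x := (l : ℝ))).mul (tendsto_inv_atTop_zero.comp h1)
  have hev : ∀ᶠ k in atTop, codeRate (reedMuller (m k) (r k)) < R + γ ∧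
      (l : ℝ) * (1 / √(m k : ℝ)) < δ * γ / 2 ∧ l + 1 ≤ m k :=
    (hrate.eventually_lt_const (by linarith)).and
      ((hsqrt.eventually_lt_const hpos).and (hm.tendsto_atTop.eventually_ge_atTop (l + 1)))
  obtain ⟨k₀, hk₀⟩ := eventually_atTop.1 hev
  refine ⟨m k₀, fun k hk i => ?_⟩
  obtain ⟨hrk, hsk, hlk⟩ := hk₀ k (hm.lt_iff_lt.1 hk).le
  have hfail : extrinsicFailure (m k) (r k) ε < δ := by
    refine lt_of_integral_mul_lt (continuous_extrinsicFailure _ _)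
      (monotoneOn_extrinsicFailure _ _) (fun p hp => extrinsicFailure_nonneg _ _ hp.1 hp.2)
      (fun p hp => extrinsicFailure_le_one _ _ hp.1 hp.2) hε0 hε hδ.le ?_
    rw [integral_extrinsicFailure]
    have h1 := integral_extrinsicFailure_mul_le (k := l) (n := m k) (by omega) (r k)
    have h2 := codeRate_reedMuller_sub_le (n := m k) (by omega) (r k) l
    have h3 : δ * γ < δ * (1 - ε - codeRate (reedMuller (m k) (r k))) :=
      mul_lt_mul_of_pos_left (by linarith) hδ
    rw [one_div_pow] at hl
    linarith
  have hmap := bernoulliMean_unrecoverableIndicator_reedMuller (r := r k) ε i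
  rw [← hmap] at hfail
  -- Either observation determines every channel output away from i, so the same bound serves for
  -- both.
  exact ⟨(bitMAPErrorProb_le _ i hε0 hε fun y y' h j _ => congrFun h j).trans hfail.le,
    (bitMAPErrorProb_le _ i hε0 hε fun y y' h j hj => congrFun h ⟨j, hj⟩).trans hfail.le⟩
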